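/- Let $r\ge 1$ and let $X=X_1\times\cdots\times X_r$ be a product of locally compact Hadamard spaces (complete geodesic metric spaces satisfying the CAT$(0)$ inequality), with the $\ell^2$-product metric. An isometry $h_i$ of $X_i$ is *rank one* if there are $l>0$ and a geodesic line $\sigma$ in $X_i$ which does not bound a flat half-plane with $h_i(\sigma(t))=\sigma(t+l)$ for all $t\in\mathbb R$; its translation length is $l_i(h_i)=l=\min_{x}d_i(x,h_ix)$. Isometries $g_i,h_i$ of $X_i$ are *independent* if for every $x\in X_i$ the map $\mathbb Z^2\to[0,\infty)$, $(m,n)\mapsto d_i(g_i^mx,h_i^nx)$, is proper. An element $\gamma=(\gamma_1,\dots,\gamma_r)$ of $\mathrm{Is}(X_1)\times\cdots\times\mathrm{Is}(X_r)$ is *regular axial* if every $\gamma_i$ is rank one, and then $L(\gamma)=(l_1(\gamma_1),\dots,l_r(\gamma_r))\in\mathbb R^r_{>0}$; two regular axial elements are independent if all their projections to the factors are. The *limit cone* $\ell_\Gamma\subset\mathbb R^r_{\ge0}$ of a subgroup $\Gamma$ of $\mathrm{Is}(X_1)\times\cdots\times\mathrm{Is}(X_r)$ is the closure of the union of the half-lines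 $\mathbb R_{\ge0}L(\gamma)$, $\gamma\in\Gamma$ regular axial. Let $\Gamma<\mathrm{Is}(X_1)\times\cdots\times\mathrm{Is}(X_r)$ act properly discontinuously on $X$ and contain two independent regular axial elements. Let $\mathcal C\subset\mathbb R^r_{>0}$ be an open cone (an open subset invariant under multiplication by positive reals) with $\mathcal C\cap\ell_\Gamma\neq\emptyset$. Then there is a free subgroup $\Gamma'<\Gamma$, freely generated by two independent regular axial elements, such that $$\ell_{\Gamma'}\setminus\{0\}\subset\mathcal C .$$ -/

import Mathlib

open Set Filter Topology

/-- `σ`, restricted to `[0, l]`, is a geodesic path from `x` to `y` of length `l` (values of `σ`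
outside `[0, l]` are irrelevant). -/
def IsGeodesicPath {X : Type*} [MetricSpace X] (σ : ℝ → X) (l : ℝ) (x y : X) : Prop :=
  0 ≤ l ∧ σ 0 = x ∧ σ l = y ∧ ∀ s ∈ Icc 0 l, ∀ t ∈ Icc 0 l, dist (σ s) (σ t) = |s - t|

/-- A Hadamard space: a complete geodesic metric space all of whose geodesic triangles satisfy the
`CAT(0)` inequality. -/
structure IsHadamardSpace (X : Type*) [MetricSpace X] : Prop where
  complete : CompleteSpace X
  geodesic : ∀ x y : X, ∃ σ : ℝ → X, IsGeodesicPath σ (dist x y) x y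
  /-- Two points on two sides of a geodesic triangle are at most as far apart as the corresponding
  points of a comparison triangle in the Euclidean plane. (The common vertex of the two sides is
  called `x`; the third side exists because the space is geodesic; two points on one and the same
  side are as far apart as their comparison points.) -/
  cat_zero : ∀ (x y z : X) (σ τ : ℝ → X),
    IsGeodesicPath σ (dist x y) x y → IsGeodesicPath τ (dist x z) x z →
    ∀ x' y' z' : EuclideanSpace ℝ (Fin 2),
      dist x' y' = dist x y → dist x' z' = dist x z → dist y' z' = dist y z →
      ∀ a ∈ Icc (0 : ℝ) 1, ∀ b ∈ Icc (0 : ℝ) 1,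
        dist (σ (a * dist x y)) (τ (b * dist x z)) ≤
          dist (AffineMap.lineMap x' y' a) (AffineMap.lineMap x' z' b)

/-- A subset of a metric space is geodesically convex if it contains every geodesic path between
any two of its points. -/
def IsGeodesicallyConvex {X : Type*} [MetricSpace X] (S : Set X) : Prop :=
  ∀ x ∈ S, ∀ y ∈ S, ∀ (σ : ℝ → X) (l : ℝ), IsGeodesicPath σ l x y → ∀ t ∈ Icc 0 l, σ t ∈ S

/-- The line `σ` bounds a flat half-plane: there is a closed convex subset
`ι ([0, ∞) × ℝ)`, isometric to the Euclidean half-plane `[0, ∞) × ℝ`, with `σ t = ι (0, t)`. -/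
def BoundsFlatHalfPlane {X : Type*} [MetricSpace X] (σ : ℝ → X) : Prop :=
  ∃ ι : ℝ × ℝ → X,
    (∀ p q : ℝ × ℝ, 0 ≤ p.1 → 0 ≤ q.1 →
      dist (ι p) (ι q) = √((p.1 - q.1) ^ 2 + (p.2 - q.2) ^ 2)) ∧
    IsClosed (ι '' (Ici 0 ×ˢ univ)) ∧
    IsGeodesicallyConvex (ι '' (Ici 0 ×ˢ univ)) ∧
    ∀ t : ℝ, σ t = ι (0, t)

/-- `σ` is an axis of the isometry `h`, along which `h` translates by `l`. -/
def IsAxis {X : Type*} [MetricSpace X] (h : X ≃ᵢ X) (σ : ℝ → X) (l : ℝ) : Prop :=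
  0 < l ∧ Isometry σ ∧ ∀ t : ℝ, h (σ t) = σ (t + l)

/-- A rank one isometry: an axial isometry possessing an axis which does not bound a flat
half-plane. -/
def IsRankOne {X : Type*} [MetricSpace X] (h : X ≃ᵢ X) : Prop :=
  ∃ (σ : ℝ → X) (l : ℝ), IsAxis h σ l ∧ ¬ BoundsFlatHalfPlane σ

/-- The translation length: the infimum of the displacement function `x ↦ d(x, h x)`. -/
noncomputable def translationLength {X : Type*} [MetricSpace X] (h : X ≃ᵢ X) : ℝ :=
  ⨅ x : X, dist x (h x)

/-- For an axial isometry, the translation length is the amount of translation along any axis. -/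
theorem IsAxis.translationLength_eq {X : Type*} [MetricSpace X] {h : X ≃ᵢ X} {σ : ℝ → X} {l : ℝ}
    (H : IsAxis h σ l) : translationLength h = l := by
  obtain ⟨hl, hσ, ht⟩ := H
  have hne : Nonempty X := ⟨σ 0⟩
  have h0 : dist (σ 0) (h (σ 0)) = l := by
    rw [ht, hσ.dist_eq, Real.dist_eq, zero_add, zero_sub, abs_neg, abs_of_pos hl]
  apply le_antisymm
  · rw [← h0]
    exact ciInf_le ⟨0, by rintro _ ⟨x, rfl⟩; exact dist_nonneg⟩ (σ 0)
  · refine le_ciInf fun x => ?_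
    have hit : ∀ n : ℕ, h^[n] (σ 0) = σ (n * l) := by
      intro n
      induction n with
      | zero => simp
      | succ n ih => rw [Function.iterate_succ_apply', ih, ht]; congr 1; push_cast; ring
    have hdist : ∀ (n : ℕ) (a b : X), dist (h^[n] a) (h^[n] b) = dist a b := by
      intro n a b
      induction n with
      | zero => simp
      | succ n ih => rw [Function.iterate_succ_apply', Function.iterate_succ_apply', h.dist_eq, ih]
    have hd : ∀ n : ℕ, dist x (h^[n] x) ≤ n * dist x (h x) := by
      intro n
      induction n with
      | zero => simp
      | succ n ih =>
        have h1 : dist (h^[n] x) (h^[n + 1] x) = dist x (h x) := by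
          rw [Function.iterate_succ_apply]
          exact hdist n _ _
        have := dist_triangle x (h^[n] x) (h^[n + 1] x)
        push_cast
        linarith
    have key : ∀ n : ℕ, (n : ℝ) * (l - dist x (h x)) ≤ 2 * dist x (σ 0) := by
      intro n
      have h1 : dist (σ 0) (h^[n] (σ 0)) = n * l := by
        rw [hit, hσ.dist_eq, Real.dist_eq, zero_sub, abs_neg, abs_of_nonneg (by positivity)]
      have h2 : dist (h^[n] x) (h^[n] (σ 0)) = dist x (σ 0) :=
        hdist n _ _
      have h3 := dist_triangle4 (σ 0) x (h^[n] x) (h^[n] (σ 0))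
      have h4 := hd n
      rw [dist_comm (σ 0) x] at h3
      linarith
    by_contra hlt
    push Not at hlt
    obtain ⟨n, hn⟩ := exists_nat_gt (2 * dist x (σ 0) / (l - dist x (h x)))
    rw [div_lt_iff₀ (by linarith)] at hn
    linarith [key n]

/-- Two isometries are independent if for every point `x` the map
`ℤ × ℤ → [0, ∞)`, `(m, n) ↦ d(g ^ m x, h ^ n x)`, is proper, i.e. all its sublevel sets are
finite. -/
def IndependentIsometries {X : Type*} [MetricSpace X] (g h : X ≃ᵢ X) : Prop :=
  ∀ x : X, Tendsto (fun p : ℤ × ℤ => dist ((g ^ p.1) x) ((h ^ p.2) x)) cofinite atTop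

section Product

variable {r : ℕ} {X : Fin r → Type*} [∀ i, MetricSpace (X i)]

/-- An element of `Is(X₁) × ⋯ × Is(X_r)` is regular axial if all its projections are rank one. -/
def IsRegularAxial (h : ∀ i, X i ≃ᵢ X i) : Prop :=
  ∀ i, IsRankOne (h i)

/-- Elements of `Is(X₁) × ⋯ × Is(X_r)` are independent if all their projections are. -/
def IndependentInFactors (g h : ∀ i, X i ≃ᵢ X i) : Prop :=
  ∀ i, IndependentIsometries (g i) (h i)

/-- The translation vector `L(h) = (l₁(h₁), …, l_r(h_r))`. -/
noncomputable def translationVector (h : ∀ i, X i ≃ᵢ X i) : Fin r → ℝ :=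
  fun i => translationLength (h i)

/-- The limit cone of `Γ`: the closure of the union of the half-lines spanned by the translation
vectors of the regular axial elements of `Γ`. -/
def limitCone (Γ : Subgroup (∀ i, X i ≃ᵢ X i)) : Set (Fin r → ℝ) :=
  closure {v | ∃ γ ∈ Γ, IsRegularAxial γ ∧ ∃ s : ℝ, 0 ≤ s ∧ v = s • translationVector γ}

/-- `Γ` acts properly discontinuously on `X₁ × ⋯ × X_r`: only finitely many elements of `Γ` move a
given compact set so that it meets itself. (The `ℓ²`-metric on the product induces the product
topology, which is the one used here.) -/
def ActsProperlyDiscontinuously (Γ : Subgroup (∀ i, X i ≃ᵢ X i)) : Prop :=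
  ∀ K : Set (∀ i, X i), IsCompact K →
    {γ : ∀ i, X i ≃ᵢ X i | γ ∈ Γ ∧ (((fun x i => γ i (x i)) '' K) ∩ K).Nonempty}.Finite

end Product

/-- An open cone in `ℝ^r_{>0}`: an open subset of the open positive orthant which is invariant under
multiplication by positive real numbers. -/
def IsOpenPositiveCone {r : ℕ} (C : Set (Fin r → ℝ)) : Prop :=
  IsOpen C ∧ (∀ v ∈ C, ∀ i, 0 < v i) ∧ ∀ v ∈ C, ∀ t : ℝ, 0 < t → t • v ∈ C

/-! ### Comparison geometry of Hadamard spaces -/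

section Geodesics

variable {X : Type*} [MetricSpace X]

/-! Since the cone is open and conical, it contains the translation vector l of some regular axial γ
in Γ. Choose δ in Γ so that in every factor the axis of γ and its image under δ have no end in
common, and take γ^N and δγ^Nδ⁻¹ as generators with N large. In each factor both generators
translate along their axes by N·lᵢ. Ping-pong along these two axes shows that an element whose
cyclically reduced word has m letters translates by m(N·lᵢ + O(1)), where the error per letter does
not depend on N (`IsPingPongPair.translation_bounds`). The number m is the same in all factors, so
every translation vector is nearly proportional to l, which is a closed condition and hence passes
to the limit cone. The same estimate in one factor gives freeness, and axes without common ends give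
independence.

The geometric input is that an axis bounding no flat half-plane is contracting: closest-point
projection sends balls disjoint from it to sets of bounded diameter. If even a weak form of this
fails, long thin families of perpendiculars to the axis converge to a flat half-plane
(`exists_weak_contraction`). The weak form implies the full one (`isContracting_of_weak`). A
geodesic between points with distant projections to a contracting line then costs, up to a constant,
as much as the detour along that line (`IsContracting.le_dist`).

The element δ is found among the products g^n h^k of powers of the given independent elements. No
independence of γ from g or h is needed: an end fixed by a nonzero power of g is an end of the axis
of g, likewise for h, and these axes share no end, so only finitely many exponents have to be
avoided (`exists_separating_zpow_mul_zpow`). -/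

theorem IsGeodesicPath.length_eq {σ : ℝ → X} {l : ℝ} {x y : X} (h : IsGeodesicPath σ l x y) :
    l = dist x y := by
  obtain ⟨h0, hx, hy, hd⟩ := h
  have := hd 0 ⟨le_rfl, h0⟩ l ⟨h0, le_rfl⟩
  rw [hx, hy, zero_sub, abs_neg, abs_of_nonneg h0] at this
  exact this.symm

theorem IsGeodesicPath.reverse {σ : ℝ → X} {l : ℝ} {x y : X} (h : IsGeodesicPath σ l x y) :
    IsGeodesicPath (fun t => σ (l - t)) l y x := by
  obtain ⟨h0, hx, hy, hd⟩ := h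
  refine ⟨h0, by simpa using hy, by simpa using hx, fun s hs t ht => ?_⟩
  have := hd (l - s) ⟨by linarith [hs.2], by linarith [hs.1]⟩ (l - t)
    ⟨by linarith [ht.2], by linarith [ht.1]⟩
  rw [this, abs_sub_comm]
  congr 1
  ring

theorem IsGeodesicPath.dist_left {σ : ℝ → X} {l : ℝ} {x y : X} (h : IsGeodesicPath σ l x y)
    {s : ℝ} (hs : s ∈ Icc 0 l) : dist x (σ s) = s := by
  have := h.2.2.2 0 ⟨le_rfl, h.1⟩ s hs
  rwa [h.2.1, zero_sub, abs_neg, abs_of_nonneg hs.1] at this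

theorem IsGeodesicPath.dist_right {σ : ℝ → X} {l : ℝ} {x y : X} (h : IsGeodesicPath σ l x y)
    {s : ℝ} (hs : s ∈ Icc 0 l) : dist (σ s) y = l - s := by
  have := h.2.2.2 s hs l ⟨h.1, le_rfl⟩
  rwa [h.2.2.1, abs_sub_comm, abs_of_nonneg (by linarith [hs.2])] at this

theorem IsGeodesicPath.sub {σ : ℝ → X} {l : ℝ} {x y : X} (h : IsGeodesicPath σ l x y) {s t : ℝ}
    (hs : 0 ≤ s) (hst : s ≤ t) (ht : t ≤ l) :
    IsGeodesicPath (fun u => σ (s + u)) (t - s) (σ s) (σ t) := by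
  refine ⟨by linarith, by simp, by simp, fun u hu v hv => ?_⟩
  rw [h.2.2.2 _ ⟨by linarith [hu.1], by linarith [hu.2]⟩ _
    ⟨by linarith [hv.1], by linarith [hv.2]⟩]
  congr 1
  ring

theorem IsGeodesicPath.continuousOn {σ : ℝ → X} {l : ℝ} {x y : X} (h : IsGeodesicPath σ l x y) :
    ContinuousOn σ (Icc 0 l) := by
  have : LipschitzOnWith 1 σ (Icc 0 l) := by
    refine LipschitzOnWith.of_dist_le_mul fun s hs t ht => ?_
    rw [h.2.2.2 s hs t ht, Real.dist_eq]
    simp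
  exact this.continuousOn

theorem Isometry.isGeodesicPath {σ : ℝ → X} (hσ : Isometry σ) {a b : ℝ} (hab : a ≤ b) :
    IsGeodesicPath (fun t => σ (a + t)) (b - a) (σ a) (σ b) := by
  refine ⟨by linarith, by simp, by simp, fun s _ t _ => ?_⟩
  rw [hσ.dist_eq, Real.dist_eq]
  congr 1
  ring

theorem Isometry.comp_neg {σ : ℝ → X} (hσ : Isometry σ) : Isometry fun t => σ (-t) :=
  by
  refine Isometry.of_dist_eq fun s t => ?_
  rw [hσ.dist_eq, dist_neg_neg]

end Geodesics

theorem exists_comparison_triangle {a b c : ℝ} (ha : 0 ≤ a) (hb : 0 ≤ b) (hc : 0 ≤ c)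
    (h1 : a ≤ b + c) (h2 : b ≤ a + c) (h3 : c ≤ a + b) :
    ∃ x y z : EuclideanSpace ℝ (Fin 2), dist x y = a ∧ dist x z = b ∧ dist y z = c := by
  rcases ha.eq_or_lt with rfl | ha'
  · have : b = c := by linarith
    subst this
    exact ⟨!₂[0, 0], !₂[0, 0], !₂[b, 0], by
      simp [EuclideanSpace.dist_eq, Real.dist_eq, Real.sqrt_sq hb]⟩
  · set u := (a ^ 2 + b ^ 2 - c ^ 2) / (2 * a) with hu
    have hu2 : 2 * a * u = a ^ 2 + b ^ 2 - c ^ 2 := by rw [hu]; field_simp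
    have hub : u ^ 2 ≤ b ^ 2 := by
      have e1 : 0 ≤ a * (b - u) := by nlinarith
      have e2 : 0 ≤ a * (b + u) := by nlinarith
      have e3 : 0 ≤ b - u := nonneg_of_mul_nonneg_right e1 ha'
      have e4 : 0 ≤ b + u := nonneg_of_mul_nonneg_right e2 ha'
      nlinarith
    have hs : √(b ^ 2 - u ^ 2) ^ 2 = b ^ 2 - u ^ 2 := Real.sq_sqrt (by linarith)
    refine ⟨!₂[0, 0], !₂[a, 0], !₂[u, √(b ^ 2 - u ^ 2)], ?_, ?_, ?_⟩
    · simp [EuclideanSpace.dist_eq, Real.dist_eq, Real.sqrt_sq ha]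
    · simp only [EuclideanSpace.dist_eq, Real.dist_eq, Fin.sum_univ_two, sq_abs]
      simp [hs, Real.sqrt_sq hb]
    · simp only [EuclideanSpace.dist_eq, Real.dist_eq, Fin.sum_univ_two, sq_abs]
      simp only [Matrix.cons_val_zero, Matrix.cons_val_one, zero_sub, neg_sq,
        Matrix.cons_val_fin_one, hs]
      rw [show (a - u) ^ 2 + (b ^ 2 - u ^ 2) = c ^ 2 by linear_combination -hu2, Real.sqrt_sq hc]

theorem dist_lineMap_sq {E : Type*} [NormedAddCommGroup E] [InnerProductSpace ℝ E] (x y z : E)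
    (t : ℝ) : dist (AffineMap.lineMap y z t) x ^ 2 =
      (1 - t) * dist x y ^ 2 + t * dist x z ^ 2 - t * (1 - t) * dist y z ^ 2 := by
  have e1 : AffineMap.lineMap y z t - x = (1 - t) • (y - x) + t • (z - x) := by
    rw [AffineMap.lineMap_apply_module]; module
  have e2 : dist y z = ‖(y - x) - (z - x)‖ := by rw [dist_eq_norm]; congr 1; abel
  rw [e2, dist_eq_norm, dist_comm x y, dist_comm x z, dist_eq_norm, dist_eq_norm, e1]
  generalize y - x = u
  generalize z - x = v
  rw [norm_add_sq_real, norm_sub_sq_real, norm_smul, norm_smul, inner_smul_left, inner_smul_right,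
    mul_pow, mul_pow, Real.norm_eq_abs, Real.norm_eq_abs, sq_abs, sq_abs]
  simp only [conj_trivial]
  ring

namespace IsHadamardSpace

variable {X : Type*} [MetricSpace X]

theorem stewart (hX : IsHadamardSpace X) {x y z : X} {σ : ℝ → X} {l : ℝ}
    (hσ : IsGeodesicPath σ l y z) {t : ℝ} (ht : t ∈ Icc (0 : ℝ) 1) :
    dist x (σ (t * l)) ^ 2 ≤
      (1 - t) * dist x y ^ 2 + t * dist x z ^ 2 - t * (1 - t) * l ^ 2 := by
  have hl := hσ.length_eq
  subst hl
  obtain ⟨τ, hτ⟩ := hX.geodesic y x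
  obtain ⟨y', z', x', h1, h2, h3⟩ := exists_comparison_triangle (a := dist y z) (b := dist y x)
    (c := dist z x) dist_nonneg dist_nonneg dist_nonneg
    (by linarith [dist_triangle y x z, dist_comm x z]) (dist_triangle _ _ _)
    (by linarith [dist_triangle z y x, dist_comm y z])
  have key := hX.cat_zero y z x σ τ hσ hτ y' z' x' h1 h2 h3 t ht 1 ⟨zero_le_one, le_rfl⟩
  rw [one_mul, hτ.2.2.1, AffineMap.lineMap_apply_one] at key
  have := dist_lineMap_sq x' y' z' t
  rw [dist_comm x' y', dist_comm x' z', h1, h2, h3] at this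
  rw [dist_comm x y, dist_comm x z, ← this, dist_comm x]
  exact pow_le_pow_left₀ dist_nonneg key 2

theorem dist_common_left_le (hX : IsHadamardSpace X) {x y z : X} {σ τ : ℝ → X} {l m : ℝ}
    (hσ : IsGeodesicPath σ l x y) (hτ : IsGeodesicPath τ m x z) {t : ℝ}
    (ht : t ∈ Icc (0 : ℝ) 1) : dist (σ (t * l)) (τ (t * m)) ≤ t * dist y z := by
  have hl := hσ.length_eq
  have hm := hτ.length_eq
  subst hl hm
  obtain ⟨x', y', z', h1, h2, h3⟩ := exists_comparison_triangle (a := dist x y) (b := dist x z)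
    (c := dist y z) dist_nonneg dist_nonneg dist_nonneg
    (by linarith [dist_triangle x z y, dist_comm z y]) (dist_triangle _ _ _)
    (by linarith [dist_triangle y x z, dist_comm x y])
  refine (hX.cat_zero x y z σ τ hσ hτ x' y' z' h1 h2 h3 t ht t ht).trans (le_of_eq ?_)
  have : AffineMap.lineMap x' y' t - AffineMap.lineMap x' z' t = t • (y' - z') := by
    rw [AffineMap.lineMap_apply_module, AffineMap.lineMap_apply_module]; module
  rw [dist_eq_norm, this, norm_smul, Real.norm_eq_abs, abs_of_nonneg ht.1, ← dist_eq_norm, h3]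

theorem dist_common_right_le (hX : IsHadamardSpace X) {x y z : X} {σ τ : ℝ → X} {l m : ℝ}
    (hσ : IsGeodesicPath σ l y x) (hτ : IsGeodesicPath τ m z x) {t : ℝ}
    (ht : t ∈ Icc (0 : ℝ) 1) : dist (σ (t * l)) (τ (t * m)) ≤ (1 - t) * dist y z := by
  have := hX.dist_common_left_le hσ.reverse hτ.reverse (t := 1 - t)
    ⟨by linarith [ht.2], by linarith [ht.1]⟩
  convert this using 3 <;> ring

/-- The distance function is convex along pairs of geodesics. -/
theorem dist_geodesics_le (hX : IsHadamardSpace X) {x y x' y' : X} {σ τ : ℝ → X} {l m : ℝ}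
    (hσ : IsGeodesicPath σ l x y) (hτ : IsGeodesicPath τ m x' y') {t : ℝ}
    (ht : t ∈ Icc (0 : ℝ) 1) :
    dist (σ (t * l)) (τ (t * m)) ≤ (1 - t) * dist x x' + t * dist y y' := by
  obtain ⟨ω, hω⟩ := hX.geodesic x y'
  have h1 := hX.dist_common_left_le hσ hω ht
  have h2 := hX.dist_common_right_le hω hτ ht
  linarith [dist_triangle (σ (t * l)) (ω (t * dist x y')) (τ (t * m))]

theorem geodesic_unique (hX : IsHadamardSpace X) {x y : X} {σ τ : ℝ → X} {l m : ℝ}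
    (hσ : IsGeodesicPath σ l x y) (hτ : IsGeodesicPath τ m x y) {t : ℝ} (ht : t ∈ Icc 0 l) :
    σ t = τ t := by
  have hlm : l = m := hσ.length_eq.trans hτ.length_eq.symm
  subst hlm
  rcases hσ.1.eq_or_lt with h0 | h0
  · have : t = 0 := le_antisymm (by linarith [ht.2]) ht.1
    rw [this, hσ.2.1, hτ.2.1]
  · have := hX.dist_geodesics_le hσ hτ (t := t / l)
      ⟨div_nonneg ht.1 h0.le, (div_le_one h0).2 ht.2⟩
    rw [div_mul_cancel₀ _ h0.ne', dist_self, dist_self, mul_zero, mul_zero, add_zero] at this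
    exact dist_le_zero.1 this

/-- The quadrilateral inequality of Reshetnyak. -/
theorem quadrilateral (hX : IsHadamardSpace X) (x y z w : X) :
    dist x z ^ 2 + dist y w ^ 2 ≤
      dist y z ^ 2 + dist w x ^ 2 + 2 * dist x y * dist z w := by
  rcases eq_or_ne x y with rfl | hxy
  · simp [dist_comm w x]
  rcases eq_or_ne z w with rfl | hzw
  · simp [dist_comm z x, add_comm]
  have ha : 0 < dist x y := dist_pos.2 hxy
  have hc : 0 < dist z w := dist_pos.2 hzw
  set a := dist x y
  set c := dist z w
  obtain ⟨σ, hσ⟩ := hX.geodesic x z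
  -- This point divides the diagonal so that (1 - t)a = tc. The error terms (1 - t)²a² + t²c² then
  -- equal exactly t(1 - t)·2ac.
  set t := a / (a + c) with ht
  have hac : 0 < a + c := by linarith
  have ht0 : 0 < t := by positivity
  have hta : t * (a + c) = a := by rw [ht]; field_simp
  have ht1 : t < 1 := by rw [ht, div_lt_one hac]; linarith
  have h1 := hX.stewart (x := y) hσ ⟨ht0.le, ht1.le⟩
  have h2 := hX.stewart (x := w) hσ ⟨ht0.le, ht1.le⟩
  set m := σ (t * dist x z)
  have h3 := dist_triangle y m w
  rw [dist_comm y x] at h1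
  rw [dist_comm w z] at h2
  rw [dist_comm m w] at h3
  set p := dist y m
  set q := dist w m
  have hp : 0 ≤ p := dist_nonneg
  have hq : 0 ≤ q := dist_nonneg
  have hf : dist y w ^ 2 ≤ (p + q) ^ 2 := pow_le_pow_left₀ dist_nonneg h3 2
  have hcs : t * (1 - t) * (p + q) ^ 2 ≤ (1 - t) * p ^ 2 + t * q ^ 2 := by
    nlinarith [sq_nonneg ((1 - t) * p - t * q)]
  change p ^ 2 ≤ (1 - t) * a ^ 2 + t * dist y z ^ 2 - t * (1 - t) * dist x z ^ 2 at h1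
  change q ^ 2 ≤ (1 - t) * dist w x ^ 2 + t * c ^ 2 - t * (1 - t) * dist x z ^ 2 at h2
  have h4 : t * (1 - t) * (dist x z ^ 2 + dist y w ^ 2) ≤
      t * (1 - t) * (dist y z ^ 2 + dist w x ^ 2) + ((1 - t) ^ 2 * a ^ 2 + t ^ 2 * c ^ 2) := by
    have e1 := mul_le_mul_of_nonneg_left h1 (by linarith : 0 ≤ 1 - t)
    have e2 := mul_le_mul_of_nonneg_left h2 ht0.le
    have e3 := mul_le_mul_of_nonneg_left hf (by nlinarith : 0 ≤ t * (1 - t))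
    nlinarith
  have h5 : (1 - t) * a = t * c := by linarith
  have h6 : (1 - t) ^ 2 * a ^ 2 + t ^ 2 * c ^ 2 = t * (1 - t) * (2 * a * c) := by
    have : (1 - t) ^ 2 * a ^ 2 = ((1 - t) * a) * ((1 - t) * a) := by ring
    rw [this]
    nth_rewrite 1 [h5]
    have : t ^ 2 * c ^ 2 = (t * c) * (t * c) := by ring
    rw [this]
    nth_rewrite 2 [← h5]
    ring
  rw [h6, ← mul_add] at h4
  exact le_of_mul_le_mul_left h4 (by nlinarith)

end IsHadamardSpace

/-! ### Closest points on a line -/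

section Foot

variable {X : Type*} [MetricSpace X]

/-- The parameter of the point of the line `σ` closest to `x`. -/
noncomputable def foot (σ : ℝ → X) (x : X) : ℝ :=
  Classical.epsilon fun a => ∀ t, dist x (σ a) ≤ dist x (σ t)

/-- The distance of `x` from the line `σ`. -/
noncomputable def height (σ : ℝ → X) (x : X) : ℝ :=
  dist x (σ (foot σ x))

theorem height_nonneg (σ : ℝ → X) (x : X) : 0 ≤ height σ x := dist_nonneg

/-- This justifies the choice by `Classical.epsilon` in `foot`: the distance to a point is coercive
along an isometrically embedded line, so a minimum is attained. -/
theorem height_le {σ : ℝ → X} (hσ : Isometry σ) (x : X) (t : ℝ) :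
    height σ x ≤ dist x (σ t) := by
  have hex : ∃ a, ∀ t, dist x (σ a) ≤ dist x (σ t) := by
    have hc : Continuous fun t => dist x (σ t) := continuous_const.dist hσ.continuous
    have hlim : Tendsto (fun t => dist x (σ t)) (cocompact ℝ) atTop := by
      have h1 : Tendsto (fun t : ℝ => ‖t‖ - dist x (σ 0)) (cocompact ℝ) atTop :=
        tendsto_atTop_add_const_right _ _ (tendsto_norm_cocompact_atTop (E := ℝ))
      refine tendsto_atTop_mono (fun t => ?_) h1
      have h2 := dist_triangle (σ t) x (σ 0)
      rw [hσ.dist_eq, Real.dist_eq, sub_zero, dist_comm (σ t) x] at h2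
      rw [Real.norm_eq_abs]
      linarith
    exact hc.exists_forall_le hlim
  exact Classical.epsilon_spec hex t

theorem height_sub_le {σ : ℝ → X} (hσ : Isometry σ) (x y : X) :
    height σ x ≤ height σ y + dist x y := by
  have := height_le hσ x (foot σ y)
  linarith [dist_triangle x y (σ (foot σ y)), show height σ y = dist y (σ (foot σ y)) from rfl]

variable (hX : IsHadamardSpace X)
include hX

/-- Stewart's inequality at the point of parameter s between σ a and σ t, combined with minimality
at σ a, can be divided by s; then s tends to 0. -/
theorem IsHadamardSpace.pythagoras {σ : ℝ → X} (hσ : Isometry σ) {x : X} {a : ℝ}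
    (ha : ∀ t, dist x (σ a) ≤ dist x (σ t)) (t : ℝ) :
    dist x (σ a) ^ 2 + (t - a) ^ 2 ≤ dist x (σ t) ^ 2 := by
  wlog hat : a ≤ t generalizing σ a t
  · have := this hσ.comp_neg (a := -a) (by simpa using fun t => ha (-t)) (-t)
      (by linarith)
    simp only [neg_neg] at this
    linarith [show (-t - -a) ^ 2 = (t - a) ^ 2 by ring]
  have hg := hσ.isGeodesicPath hat
  have key : ∀ s ∈ Ioo (0 : ℝ) 1,
      dist x (σ a) ^ 2 + (1 - s) * (t - a) ^ 2 ≤ dist x (σ t) ^ 2 := by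
    intro s hs
    have h1 := hX.stewart (x := x) hg ⟨hs.1.le, hs.2.le⟩
    have h2 := pow_le_pow_left₀ dist_nonneg (ha (a + s * (t - a))) 2
    have h3 : s * (dist x (σ a) ^ 2 + (1 - s) * (t - a) ^ 2) ≤ s * dist x (σ t) ^ 2 := by
      linarith
    exact le_of_mul_le_mul_left h3 hs.1
  have hlim : Tendsto (fun s : ℝ => dist x (σ a) ^ 2 + (1 - s) * (t - a) ^ 2) (𝓝[>] 0)
      (𝓝 (dist x (σ a) ^ 2 + (1 - 0) * (t - a) ^ 2)) := by
    apply Tendsto.mono_left _ nhdsWithin_le_nhds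
    apply Continuous.tendsto
    fun_prop
  have := le_of_tendsto hlim (by
    filter_upwards [Ioo_mem_nhdsGT (zero_lt_one' ℝ)] with s hs using key s hs)
  linarith

theorem IsHadamardSpace.height_sq_add_le {σ : ℝ → X} (hσ : Isometry σ) (x : X) (t : ℝ) :
    height σ x ^ 2 + (t - foot σ x) ^ 2 ≤ dist x (σ t) ^ 2 :=
  hX.pythagoras hσ (fun t => height_le hσ x t) t

theorem IsHadamardSpace.foot_eq {σ : ℝ → X} (hσ : Isometry σ) {x : X} {a : ℝ}
    (ha : ∀ t, dist x (σ a) ≤ dist x (σ t)) : foot σ x = a := by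
  have h1 := hX.pythagoras hσ ha (foot σ x)
  have h2 := pow_le_pow_left₀ (height_nonneg σ x) (height_le hσ x a) 2
  have h3 : (foot σ x - a) ^ 2 ≤ 0 := by
    rw [show dist x (σ (foot σ x)) = height σ x from rfl] at h1
    linarith
  have := pow_eq_zero_iff (two_ne_zero) |>.1 (le_antisymm h3 (sq_nonneg _))
  linarith

theorem IsHadamardSpace.foot_line {σ : ℝ → X} (hσ : Isometry σ) (a : ℝ) :
    foot σ (σ a) = a :=
  hX.foot_eq hσ fun t => by rw [dist_self]; exact dist_nonneg

theorem IsHadamardSpace.height_line {σ : ℝ → X} (hσ : Isometry σ) (a : ℝ) :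
    height σ (σ a) = 0 := by
  rw [height, hX.foot_line hσ, dist_self]

/-- The map (height, foot) to the Euclidean half-plane is 1-Lipschitz. The quadrilateral inequality
for x, y and their feet bounds the diagonals, and the Pythagorean inequality bounds them from below.
-/
theorem IsHadamardSpace.foot_sub_sq_add_le {σ : ℝ → X} (hσ : Isometry σ) (x y : X) :
    (foot σ x - foot σ y) ^ 2 + (height σ x - height σ y) ^ 2 ≤ dist x y ^ 2 := by
  have h1 := hX.height_sq_add_le hσ x (foot σ y)
  have h2 := hX.height_sq_add_le hσ y (foot σ x)
  have h3 := hX.quadrilateral x (σ (foot σ x)) (σ (foot σ y)) y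
  rw [hσ.dist_eq, Real.dist_eq, sq_abs, dist_comm (σ (foot σ x)) y, dist_comm y x,
    dist_comm (σ (foot σ y)) y] at h3
  change _ ≤ _ + 2 * height σ x * height σ y at h3
  nlinarith

theorem IsHadamardSpace.abs_foot_sub_le {σ : ℝ → X} (hσ : Isometry σ) (x y : X) :
    |foot σ x - foot σ y| ≤ dist x y := by
  apply abs_le_of_sq_le_sq _ dist_nonneg
  linarith [hX.foot_sub_sq_add_le hσ x y, sq_nonneg (height σ x - height σ y)]

theorem IsHadamardSpace.continuous_foot {σ : ℝ → X} (hσ : Isometry σ) :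
    Continuous (foot σ) := by
  refine (LipschitzWith.of_dist_le_mul (K := 1) fun x y => ?_).continuous
  rw [Real.dist_eq, NNReal.coe_one, one_mul]
  exact hX.abs_foot_sub_le hσ x y

theorem IsHadamardSpace.foot_of_between {σ : ℝ → X} (hσ : Isometry σ) {x w : X}
    (hw : dist x w + dist w (σ (foot σ x)) = height σ x) :
    foot σ w = foot σ x ∧ height σ w = dist w (σ (foot σ x)) := by
  have h : foot σ w = foot σ x := by
    refine hX.foot_eq hσ fun t => ?_
    linarith [height_le hσ x t, dist_triangle x w (σ t)]
  exact ⟨h, by rw [height, h]⟩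

theorem IsHadamardSpace.foot_translate {σ : ℝ → X} (hσ : Isometry σ) (h : X ≃ᵢ X) {l : ℝ}
    (hl : ∀ t, h (σ t) = σ (t + l)) (x : X) : foot σ (h x) = foot σ x + l := by
  refine hX.foot_eq hσ fun t => ?_
  rw [← hl, h.dist_eq, show σ t = h (σ (t - l)) by rw [hl, sub_add_cancel], h.dist_eq]
  exact height_le hσ x _

theorem IsHadamardSpace.height_translate {σ : ℝ → X} (hσ : Isometry σ) (h : X ≃ᵢ X) {l : ℝ}
    (hl : ∀ t, h (σ t) = σ (t + l)) (x : X) : height σ (h x) = height σ x := by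
  rw [height, hX.foot_translate hσ h hl, ← hl, h.dist_eq, height]

theorem IsHadamardSpace.foot_comp_neg {σ : ℝ → X} (hσ : Isometry σ) (x : X) :
    foot (fun t => σ (-t)) x = -foot σ x := by
  refine hX.foot_eq hσ.comp_neg fun t => ?_
  rw [neg_neg]
  exact height_le hσ x _

theorem IsHadamardSpace.height_comp_neg {σ : ℝ → X} (hσ : Isometry σ) (x : X) :
    height (fun t => σ (-t)) x = height σ x := by
  rw [height, hX.foot_comp_neg hσ, neg_neg, height]

end Foot

/-! ### Local compactness implies properness -/

section HopfRinow

variable {X : Type*} [MetricSpace X]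

theorem IsHadamardSpace.exists_dist_le (hX : IsHadamardSpace X) {x y : X} {r e : ℝ} (hr : 0 ≤ r)
    (he : 0 ≤ e) (hy : dist x y ≤ r + e) : ∃ z, dist x z ≤ r ∧ dist z y ≤ e := by
  obtain ⟨σ, hσ⟩ := hX.geodesic x y
  have hs : min r (dist x y) ∈ Icc 0 (dist x y) := ⟨le_min hr dist_nonneg, min_le_right _ _⟩
  refine ⟨σ (min r (dist x y)), ?_, ?_⟩
  · rw [hσ.dist_left hs]; exact min_le_left _ _
  · rw [hσ.dist_right hs]
    rcases min_cases r (dist x y) with h | h <;> linarith [h.1]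

/-- A locally compact Hadamard space is proper. -/
theorem IsHadamardSpace.properSpace [LocallyCompactSpace X] (hX : IsHadamardSpace X) :
    ProperSpace X := by
  have := hX.complete
  refine ⟨fun x r => ?_⟩
  by_contra hr
  -- R is the infimum of the radii of non-compact balls about x. The R-ball is compact, because
  -- slightly smaller balls approximate it; by local compactness it has a compact neighbourhood,
  -- which contains a larger ball and contradicts the choice of R.
  set B := {r : ℝ | ¬ IsCompact (Metric.closedBall x r)} with hB
  have hB0 : ∀ s ∈ B, 0 ≤ s := by
    intro s hs
    by_contra h
    exact hs (by rw [Metric.closedBall_eq_empty.2 (not_le.1 h)]; exact isCompact_empty)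
  have hBb : BddBelow B := ⟨0, hB0⟩
  set R := sInf B
  have hR0 : 0 ≤ R := le_csInf ⟨r, hr⟩ hB0
  have hlt : ∀ s < R, IsCompact (Metric.closedBall x s) := by
    intro s hs
    by_contra h
    exact absurd (csInf_le hBb (show s ∈ B from h)) (not_le.2 hs)
  have hRc : IsCompact (Metric.closedBall x R) := by
    refine isCompact_iff_totallyBounded_isComplete.2 ⟨?_, Metric.isClosed_closedBall.isComplete⟩
    refine Metric.totallyBounded_iff.2 fun e he => ?_
    obtain ⟨t, htf, ht⟩ := Metric.totallyBounded_iff.1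
      (hlt (R - e / 4) (by linarith)).totallyBounded (e / 2) (by linarith)
    rcases lt_or_ge R (e / 2) with hRe | hRe
    · refine ⟨{x}, finite_singleton x, fun y hy => ?_⟩
      simp only [mem_singleton_iff, iUnion_iUnion_eq_left, Metric.mem_ball]
      linarith [Metric.mem_closedBall.1 hy]
    · refine ⟨t, htf, fun y hy => ?_⟩
      obtain ⟨z, hz1, hz2⟩ := hX.exists_dist_le (x := x) (y := y) (r := R - e / 4) (e := e / 4)
        (by linarith) (by linarith) (by linarith [Metric.mem_closedBall'.1 hy])
      have := ht (Metric.mem_closedBall'.2 hz1)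
      simp only [mem_iUnion, Metric.mem_ball] at this ⊢
      obtain ⟨w, hw, hzw⟩ := this
      exact ⟨w, hw, by linarith [dist_triangle y z w, dist_comm y z]⟩
  obtain ⟨K, hK, hKn⟩ := exists_compact_superset hRc
  obtain ⟨δ, hδ, hδK⟩ := hRc.exists_cthickening_subset_open isOpen_interior hKn
  have hbig : IsCompact (Metric.closedBall x (R + δ)) := by
    refine hK.of_isClosed_subset Metric.isClosed_closedBall fun y hy => ?_
    obtain ⟨z, hz1, hz2⟩ := hX.exists_dist_le hR0 hδ.le (Metric.mem_closedBall'.1 hy)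
    refine interior_subset (hδK (Metric.mem_cthickening_of_dist_le y z δ _
      (Metric.mem_closedBall'.2 hz1) (by rwa [dist_comm])))
  have : R + δ ≤ R := by
    refine le_csInf ⟨r, hr⟩ fun s hs => ?_
    by_contra h
    exact hs (hbig.of_isClosed_subset Metric.isClosed_closedBall
      (Metric.closedBall_subset_closedBall (not_le.1 h).le))
  linarith

end HopfRinow

/-! ### Axes which do not bound flat half-planes are weakly contracting -/

section HalfPlane

variable {X : Type*} [MetricSpace X]

/-- Upper bounds are only needed on vertical and horizontal distances. They bound the sum of the
squared diagonals of a coordinate rectangle by twice the Euclidean value, while each diagonal is at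
least Euclidean because (height, foot) is 1-Lipschitz; hence both are equal to it. -/
theorem IsHadamardSpace.boundsFlatHalfPlane_of_coordinates (hX : IsHadamardSpace X) {σ : ℝ → X}
    (hσ : Isometry σ) (G : ℝ × ℝ → X) (hfoot : ∀ p : ℝ × ℝ, 0 ≤ p.1 → foot σ (G p) = p.2)
    (hheight : ∀ p : ℝ × ℝ, 0 ≤ p.1 → height σ (G p) = p.1)
    (hvert : ∀ s s' t : ℝ, 0 ≤ s → 0 ≤ s' → dist (G (s, t)) (G (s', t)) ≤ |s - s'|)
    (hhor : ∀ s t t' : ℝ, 0 ≤ s → dist (G (s, t)) (G (s, t')) ≤ |t - t'|) :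
    BoundsFlatHalfPlane σ := by
  have hsq : ∀ p q : ℝ × ℝ, 0 ≤ p.1 → 0 ≤ q.1 →
      dist (G p) (G q) ^ 2 = (p.1 - q.1) ^ 2 + (p.2 - q.2) ^ 2 := by
    rintro ⟨s, t⟩ ⟨s', t'⟩ hs hs'
    simp only at hs hs' ⊢
    have low : ∀ u u' v v' : ℝ, 0 ≤ u → 0 ≤ u' →
        (u - u') ^ 2 + (v - v') ^ 2 ≤ dist (G (u, v)) (G (u', v')) ^ 2 := by
      intro u u' v v' hu hu'
      have := hX.foot_sub_sq_add_le hσ (G (u, v)) (G (u', v'))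
      rw [hfoot _ hu, hfoot _ hu', hheight _ hu, hheight _ hu'] at this
      linarith
    refine le_antisymm ?_ (low s s' t t' hs hs')
    have h1 := hX.quadrilateral (G (s, t)) (G (s, t')) (G (s', t')) (G (s', t))
    have h2 := low s s' t' t hs hs'
    have h3 := pow_le_pow_left₀ dist_nonneg (hvert s s' t' hs hs') 2
    have h4 := pow_le_pow_left₀ dist_nonneg (hvert s' s t hs' hs) 2
    have h5 : dist (G (s, t)) (G (s, t')) * dist (G (s', t')) (G (s', t)) ≤
        |t - t'| * |t - t'| := by
      refine mul_le_mul (hhor s t t' hs) ?_ dist_nonneg (abs_nonneg _)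
      rw [abs_sub_comm]
      exact hhor s' t' t hs'
    rw [abs_mul_abs_self] at h5
    rw [sq_abs] at h3 h4
    nlinarith
  have hsqrt : ∀ p q : ℝ × ℝ, 0 ≤ p.1 → 0 ≤ q.1 →
      dist (G p) (G q) = √((p.1 - q.1) ^ 2 + (p.2 - q.2) ^ 2) := by
    intro p q hp hq
    rw [← hsq p q hp hq, Real.sqrt_sq dist_nonneg]
  refine ⟨G, hsqrt, ?_, ?_, ?_⟩
  · have himg : G '' (Ici 0 ×ˢ univ) = {y | G (height σ y, foot σ y) = y} := by
      ext y
      constructor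
      · rintro ⟨p, ⟨hp, -⟩, rfl⟩
        change G _ = _
        rw [hfoot p hp, hheight p hp]
      · intro hy
        exact ⟨(height σ y, foot σ y), ⟨height_nonneg σ y, mem_univ _⟩, hy⟩
    rw [himg]
    refine isClosed_eq ?_ continuous_id
    refine (LipschitzWith.of_dist_le_mul (K := 1) fun x y => ?_).continuous
    rw [NNReal.coe_one, one_mul]
    refine le_of_sq_le_sq ?_ dist_nonneg
    rw [hsq _ _ (height_nonneg σ x) (height_nonneg σ y)]
    linarith [hX.foot_sub_sq_add_le hσ x y]
  · rintro _ ⟨p, ⟨hp, -⟩, rfl⟩ _ ⟨q, ⟨hq, -⟩, rfl⟩ τ l hτ t ht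
    have hp' : 0 ≤ p.1 := hp
    have hq' : 0 ≤ q.1 := hq
    rcases hτ.1.eq_or_lt with h0 | h0
    · have : t = 0 := le_antisymm (by linarith [ht.2]) ht.1
      rw [this, hτ.2.1]
      exact ⟨p, ⟨hp, mem_univ _⟩, rfl⟩
    set ω : ℝ → ℝ × ℝ := fun u => (p.1 + u / l * (q.1 - p.1), p.2 + u / l * (q.2 - p.2)) with hω
    have hω0 : ∀ u ∈ Icc 0 l, 0 ≤ (ω u).1 := by
      intro u hu
      have h1 : 0 ≤ u / l := div_nonneg hu.1 h0.le
      have h2 : u / l ≤ 1 := (div_le_one h0).2 hu.2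
      simp only [hω]
      nlinarith
    have hl2 : (p.1 - q.1) ^ 2 + (p.2 - q.2) ^ 2 = l ^ 2 := by
      rw [← hsq p q hp hq, hτ.length_eq]
    have hg : IsGeodesicPath (fun u => G (ω u)) l (G p) (G q) := by
      refine ⟨h0.le, by simp [hω], by simp [hω, h0.ne'], fun u hu v hv => ?_⟩
      rw [hsqrt _ _ (hω0 u hu) (hω0 v hv)]
      have : ((ω u).1 - (ω v).1) ^ 2 + ((ω u).2 - (ω v).2) ^ 2 = (u - v) ^ 2 := by
        have e : ((ω u).1 - (ω v).1) ^ 2 + ((ω u).2 - (ω v).2) ^ 2 =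
            (u / l - v / l) ^ 2 * ((p.1 - q.1) ^ 2 + (p.2 - q.2) ^ 2) := by
          simp only [hω]; ring
        rw [e, hl2]
        field_simp
      rw [this, Real.sqrt_sq_eq_abs]
    rw [hX.geodesic_unique hτ hg ht]
    exact ⟨ω t, ⟨hω0 t ht, mem_univ _⟩, rfl⟩
  · intro t
    have := hheight (0, t) le_rfl
    rw [height, hfoot (0, t) le_rfl] at this
    exact (dist_eq_zero.1 this).symm

/-- The limit is taken pointwise along an ultrafilter. It exists since F n (s, t) eventually lies in
the compact ball of radius s about σ t, and no continuity of F n is required. -/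
theorem IsHadamardSpace.boundsFlatHalfPlane_of_approx [ProperSpace X] (hX : IsHadamardSpace X)
    {σ : ℝ → X} (hσ : Isometry σ) (F : ℕ → ℝ × ℝ → X)
    (hfoot : ∀ (n : ℕ) (s t : ℝ), s ∈ Icc (0 : ℝ) n → |t| ≤ n → foot σ (F n (s, t)) = t)
    (hheight : ∀ (n : ℕ) (s t : ℝ), s ∈ Icc (0 : ℝ) n → |t| ≤ n → height σ (F n (s, t)) = s)
    (hvert : ∀ (n : ℕ) (s s' t : ℝ), s ∈ Icc (0 : ℝ) n → s' ∈ Icc (0 : ℝ) n → |t| ≤ n →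
      dist (F n (s, t)) (F n (s', t)) ≤ |s - s'|)
    (hhor : ∀ (n : ℕ) (s t t' : ℝ), s ∈ Icc (0 : ℝ) n → |t| ≤ n → |t'| ≤ n →
      dist (F n (s, t)) (F n (s, t')) ≤ |t - t'| + s * (4 / (n + 2))) :
    BoundsFlatHalfPlane σ := by
  set U : Ultrafilter ℕ := hyperfilter ℕ with hU
  have hge : ∀ r : ℝ, ∀ᶠ n : ℕ in (U : Filter ℕ), r ≤ n := fun r =>
    Nat.hyperfilter_le_atTop (tendsto_natCast_atTop_atTop.eventually_ge_atTop r)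
  have hlim : ∀ p : ℝ × ℝ, ∃ y, 0 ≤ p.1 → Tendsto (fun n => F n p) U (𝓝 y) := by
    rintro ⟨s, t⟩
    by_cases hs : 0 ≤ s
    · have hev : ∀ᶠ n : ℕ in (U : Filter ℕ), F n (s, t) ∈ Metric.closedBall (σ t) s := by
        filter_upwards [hge s, hge |t|] with n h1 h2
        rw [Metric.mem_closedBall]
        have := hheight n s t ⟨hs, h1⟩ h2
        rw [height, hfoot n s t ⟨hs, h1⟩ h2] at this
        exact this.le
      obtain ⟨y, -, hy⟩ := (isCompact_closedBall (σ t) s).ultrafilter_le_nhds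
        (U.map fun n => F n (s, t)) (by rw [Ultrafilter.coe_map]; exact tendsto_principal.2 hev)
      exact ⟨y, fun _ => hy⟩
    · exact ⟨σ 0, fun h => absurd h hs⟩
  choose G hG using hlim
  refine hX.boundsFlatHalfPlane_of_coordinates hσ G ?_ ?_ ?_ ?_
  · rintro ⟨s, t⟩ hs
    refine tendsto_nhds_unique ((hX.continuous_foot hσ).tendsto _ |>.comp (hG _ hs)) ?_
    refine tendsto_const_nhds.congr' ?_
    filter_upwards [hge s, hge |t|] with n h1 h2
    exact (hfoot n s t ⟨hs, h1⟩ h2).symm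
  · rintro ⟨s, t⟩ hs
    have hc : Continuous (height σ) :=
      continuous_id.dist (hσ.continuous.comp (hX.continuous_foot hσ))
    refine tendsto_nhds_unique (hc.tendsto _ |>.comp (hG _ hs)) ?_
    refine tendsto_const_nhds.congr' ?_
    filter_upwards [hge s, hge |t|] with n h1 h2
    exact (hheight n s t ⟨hs, h1⟩ h2).symm
  · intro s s' t hs hs'
    refine le_of_tendsto ((hG (s, t) hs).dist (hG (s', t) hs')) ?_
    filter_upwards [hge s, hge s', hge |t|] with n h1 h2 h3
    exact hvert n s s' t ⟨hs, h1⟩ ⟨hs', h2⟩ h3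
  · intro s t t' hs
    have h0 : Tendsto (fun n : ℕ => |t - t'| + s * (4 / ((n : ℝ) + 2))) U
        (𝓝 (|t - t'| + s * 0)) := by
      refine Tendsto.mono_left ?_ Nat.hyperfilter_le_atTop
      refine tendsto_const_nhds.add (tendsto_const_nhds.mul ?_)
      exact tendsto_const_nhds.div_atTop
        (tendsto_atTop_add_const_right _ _ tendsto_natCast_atTop_atTop)
    rw [mul_zero, add_zero] at h0
    refine le_of_tendsto_of_tendsto ((hG (s, t) hs).dist (hG (s, t') hs)) h0 ?_
    filter_upwards [hge s, hge |t|, hge |t'|] with n h1 h2 h3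
    exact hhor n s t t' ⟨hs, h1⟩ h2 h3

/-- A geodesic whose endpoints have far apart feet contains points with prescribed feet. -/
theorem IsHadamardSpace.exists_foot_eq (hX : IsHadamardSpace X) {σ : ℝ → X} (hσ : Isometry σ)
    {x y : X} {t : ℝ} (ht : t ∈ uIcc (foot σ x) (foot σ y)) {τ : ℝ → X} {l : ℝ}
    (hτ : IsGeodesicPath τ l x y) : ∃ s ∈ Icc 0 l, foot σ (τ s) = t := by
  have hc : ContinuousOn (fun s => foot σ (τ s)) (uIcc 0 l) := by
    rw [uIcc_of_le hτ.1]
    exact (hX.continuous_foot hσ).comp_continuousOn hτ.continuousOn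
  have := intermediate_value_uIcc hc
  simp only [hτ.2.1, hτ.2.2.1, uIcc_of_le hτ.1] at this
  exact this ht

theorem IsAxis.zpow_apply {h : X ≃ᵢ X} {σ : ℝ → X} {l : ℝ} (H : IsAxis h σ l) (k : ℤ) (t : ℝ) :
    (h ^ k) (σ t) = σ (t + k * l) := by
  induction k using Int.induction_on generalizing t with
  | zero => simp
  | succ n ih =>
    rw [zpow_add_one, IsometryEquiv.mul_apply, H.2.2, ih]
    congr 1; push_cast; ring
  | pred n ih =>
    have h1 : (h⁻¹) (σ t) = σ (t - l) := by
      have := H.2.2 (t - l)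
      rw [sub_add_cancel] at this
      rw [← this, IsometryEquiv.inv_apply_self]
    rw [zpow_sub_one, IsometryEquiv.mul_apply, h1, ih]
    congr 1; push_cast; ring

/-- If all constants fail, there are points x, y very close together relative to their height whose
feet are far apart. The perpendiculars from the segment xy to σ then form an almost flat strip that
is long in both directions; powers of h centre these strips, and their limit is a flat half-plane.
-/
theorem IsHadamardSpace.exists_weak_contraction [ProperSpace X] (hX : IsHadamardSpace X)
    {h : X ≃ᵢ X} {σ : ℝ → X} {l : ℝ} (H : IsAxis h σ l) (hσ' : ¬ BoundsFlatHalfPlane σ) :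
    ∃ κ > 0, ∃ M : ℝ, 0 < M ∧ κ ≤ 1 ∧
      ∀ x y, dist x y ≤ κ * height σ x → |foot σ x - foot σ y| ≤ M := by
  by_contra hcon
  push Not at hcon
  apply hσ'
  obtain ⟨hl, hσ, -⟩ := id H
  have hA : ∀ n : ℕ, ∃ x y, dist x y ≤ 1 / ((n : ℝ) + 2) * height σ x ∧
      2 * (n : ℝ) ≤ dist x y ∧ Icc (-(n : ℝ)) n ⊆ uIcc (foot σ x) (foot σ y) := by
    intro n
    have hn : (0 : ℝ) ≤ n := n.cast_nonneg
    -- After translation the midpoint of the two feet lies in [0, l]. A gap above 2n + 2l therefore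
    -- leaves [-n, n] between the feet.
    obtain ⟨x, y, hxy, hf⟩ := hcon (1 / ((n : ℝ) + 2)) (by positivity) (2 * n + 2 * l)
      (by positivity) (by rw [div_le_one (by positivity)]; linarith)
    set k : ℤ := -⌊(foot σ x + foot σ y) / 2 / l⌋ with hk
    have hkl : ∀ t, (h ^ k) (σ t) = σ (t + k * l) := H.zpow_apply k
    have hmid : 0 ≤ (foot σ x + foot σ y) / 2 + k * l ∧
        (foot σ x + foot σ y) / 2 + k * l ≤ l := by
      have h1 := Int.floor_le ((foot σ x + foot σ y) / 2 / l)
      have h2 := (Int.lt_floor_add_one ((foot σ x + foot σ y) / 2 / l)).le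
      rw [le_div_iff₀ hl] at h1
      rw [div_le_iff₀ hl] at h2
      rw [hk]; push_cast
      constructor <;> linarith
    refine ⟨(h ^ k) x, (h ^ k) y, ?_, ?_, ?_⟩
    · rwa [(h ^ k).dist_eq, hX.height_translate hσ _ hkl]
    · rw [(h ^ k).dist_eq]
      linarith [hX.abs_foot_sub_le hσ x y]
    · rw [hX.foot_translate hσ _ hkl, hX.foot_translate hσ _ hkl]
      intro t ht
      rcases lt_abs.1 hf with h1 | h1
      · rw [uIcc_of_ge (by linarith)]
        constructor <;> linarith [ht.1, ht.2]
      · rw [uIcc_of_le (by linarith)]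
        constructor <;> linarith [ht.1, ht.2]
  have hC : ∀ n : ℕ, ∃ F : ℝ × ℝ → X, ∀ s t : ℝ, s ∈ Icc (0 : ℝ) n → |t| ≤ n →
      foot σ (F (s, t)) = t ∧ height σ (F (s, t)) = s ∧
      (∀ s' ∈ Icc (0 : ℝ) n, dist (F (s, t)) (F (s', t)) ≤ |s - s'|) ∧
      ∀ t' : ℝ, |t'| ≤ n → dist (F (s, t)) (F (s, t')) ≤ |t - t'| + s * (4 / (n + 2)) := by
    intro n
    obtain ⟨x, y, hxy, hdn, hsub⟩ := hA n
    set A := height σ x with hAdef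
    have hn : (0 : ℝ) ≤ n := n.cast_nonneg
    have hn2 : (0 : ℝ) < n + 2 := by linarith
    have hdA : dist x y * (n + 2) ≤ A := by
      rw [one_div, inv_mul_eq_div, le_div_iff₀ hn2] at hxy
      exact hxy
    have hd0 : 0 ≤ dist x y := dist_nonneg
    have hA1 : 2 * dist x y ≤ A := by nlinarith
    have hA2 : 2 * n ≤ A := by nlinarith
    -- By the intermediate value theorem every t in [-n, n] is the foot of some z t on the segment
    -- xy. All heights there are at least A / 2 ≥ n, so the perpendicular c t from σ t to z t has
    -- length at least n, and F (s, t) is its point at height s.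
    obtain ⟨τ, hτ⟩ := hX.geodesic x y
    have hz : ∀ t : ℝ, ∃ z, |t| ≤ (n : ℝ) → foot σ z = t ∧ ∃ u ∈ Icc 0 (dist x y), z = τ u := by
      intro t
      by_cases ht : |t| ≤ (n : ℝ)
      · obtain ⟨u, hu, hut⟩ := hX.exists_foot_eq hσ (hsub (abs_le.1 ht)) hτ
        exact ⟨τ u, fun _ => ⟨hut, u, hu, rfl⟩⟩
      · exact ⟨x, fun h => absurd h ht⟩
    choose z hzf hzt using hz
    have hzz : ∀ t t' : ℝ, |t| ≤ n → |t'| ≤ n → dist (z t) (z t') ≤ dist x y := by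
      intro t t' ht ht'
      obtain ⟨u, hu, hzu⟩ := hzt t ht
      obtain ⟨v, hv, hzv⟩ := hzt t' ht'
      rw [hzu, hzv, hτ.2.2.2 u hu v hv, abs_le]
      constructor <;> linarith [hu.1, hu.2, hv.1, hv.2]
    have hzh : ∀ t : ℝ, |t| ≤ n → A / 2 ≤ height σ (z t) := by
      intro t ht
      obtain ⟨u, hu, hzu⟩ := hzt t ht
      have h1 := height_sub_le hσ x (z t)
      rw [hzu, hτ.dist_left hu, ← hzu] at h1
      linarith [hu.2]
    choose c hc using fun t => hX.geodesic (σ t) (z t)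
    have hdz : ∀ t : ℝ, |t| ≤ n → dist (σ t) (z t) = height σ (z t) := by
      intro t ht
      rw [height, hzf t ht, dist_comm]
    have hmem : ∀ s t : ℝ, s ∈ Icc (0 : ℝ) n → |t| ≤ n → s ∈ Icc 0 (dist (σ t) (z t)) := by
      intro s t hs ht
      rw [hdz t ht]
      exact ⟨hs.1, by linarith [hs.2, hzh t ht]⟩
    refine ⟨fun p => c p.2 p.1, fun s t hs ht => ?_⟩
    have hfh := hX.foot_of_between hσ (x := z t) (w := c t s) (by
      rw [hzf t ht, dist_comm (z t), (hc t).dist_right (hmem s t hs ht), dist_comm (c t s),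
        (hc t).dist_left (hmem s t hs ht), hdz t ht]
      ring)
    rw [hzf t ht] at hfh
    refine ⟨hfh.1, ?_, fun s' hs' => ?_, fun t' ht' => ?_⟩
    · rw [hfh.2, dist_comm, (hc t).dist_left (hmem s t hs ht)]
    · exact ((hc t).2.2.2 s (hmem s t hs ht) s' (hmem s' t hs' ht)).le
    · change dist (c t s) (c t' s) ≤ _
      rcases hs.1.eq_or_lt with h0 | h0
      · rw [← h0, (hc t).2.1, (hc t').2.1, hσ.dist_eq, Real.dist_eq]
        simp
      have hApos : 0 < A := by linarith [hs.2]
      set Ht := dist (σ t) (z t) with hHt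
      set Ht' := dist (σ t') (z t') with hHt'
      have hH : A / 2 ≤ Ht := by rw [hHt, hdz t ht]; exact hzh t ht
      have hHpos : 0 < Ht := by linarith
      set r := s / Ht with hr
      have hr0 : 0 ≤ r := div_nonneg hs.1 hHpos.le
      have hr1 : r ≤ 1 := (div_le_one hHpos).2 (hmem s t hs ht).2
      have hrs : r * Ht = s := div_mul_cancel₀ _ hHpos.ne'
      have hrA : r * dist x y ≤ s * (2 / (n + 2)) := by
        rw [mul_div_assoc', le_div_iff₀ hn2]
        nlinarith
      -- Convexity compares points at equal fractions r of two perpendiculars of different lengths;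
      -- `h3` corrects the second point to height s. The endpoints z t, z t' and this correction
      -- each contribute at most r · dist x y ≤ 2s/(n + 2).
      have h1 := hX.dist_geodesics_le (hc t) (hc t') ⟨hr0, hr1⟩
      rw [← hHt, ← hHt', hrs, hσ.dist_eq, Real.dist_eq] at h1
      have hH'0 : 0 ≤ Ht' := dist_nonneg
      have h2 : dist (c t' (r * Ht')) (c t' s) = |r * Ht' - s| :=
        (hc t').2.2.2 _ ⟨by positivity, by nlinarith⟩ _ (hmem s t' hs ht')
      have h3 : |r * Ht' - s| ≤ r * dist x y := by
        have e : r * Ht' - s = r * (Ht' - Ht) := by rw [mul_sub, hrs]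
        rw [e, abs_mul, abs_of_nonneg hr0]
        refine mul_le_mul_of_nonneg_left ?_ hr0
        refine le_trans ?_ (hzz t t' ht ht')
        rw [hHt, hHt', hdz t ht, hdz t' ht', abs_le]
        constructor <;> linarith [height_sub_le hσ (z t) (z t'), height_sub_le hσ (z t') (z t),
          dist_comm (z t) (z t')]
      have h4 := hzz t t' ht ht'
      have h5 : r * dist (z t) (z t') ≤ r * dist x y := mul_le_mul_of_nonneg_left h4 hr0
      have h6 : (1 - r) * |t - t'| ≤ |t - t'| := by nlinarith [abs_nonneg (t - t')]
      have h7 : s * (4 / ((n : ℝ) + 2)) = 2 * (s * (2 / (n + 2))) := by ring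
      linarith [dist_triangle (c t s) (c t' (r * Ht')) (c t' s)]
  choose F hF using hC
  exact hX.boundsFlatHalfPlane_of_approx hσ F (fun n s t hs ht => (hF n s t hs ht).1)
    (fun n s t hs ht => (hF n s t hs ht).2.1)
    (fun n s s' t hs hs' ht => (hF n s t hs ht).2.2.1 s' hs')
    (fun n s t t' hs ht ht' => (hF n s t hs ht).2.2.2 t' ht')

end HalfPlane

/-! ### Contracting lines -/

theorem abs_sub_le_of_forall_short {f : ℝ → ℝ} {δ M : ℝ} (hδ : 0 < δ) (hM : 0 ≤ M) {a b : ℝ}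
    (hab : a ≤ b)
    (hf : ∀ s t, a ≤ s → s ≤ t → t ≤ b → t - s ≤ δ → |f s - f t| ≤ M) :
    |f a - f b| ≤ M * ((b - a) / δ + 1) := by
  have key : ∀ (n : ℕ) (c : ℝ), a ≤ c → c ≤ b → c - a ≤ n * δ → |f a - f c| ≤ n * M := by
    intro n
    induction n with
    | zero =>
      intro c hc _ h
      have : c = a := by
        rw [Nat.cast_zero, zero_mul] at h
        linarith
      simp [this]
    | succ n ih =>
      intro c hc hcb h
      push_cast at h ⊢
      rcases le_total (c - a) (n * δ) with h1 | h1
      · have := ih c hc hcb h1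
        nlinarith
      · have e1 : 0 ≤ n * δ := by positivity
        have h2 := ih (a + n * δ) (by linarith) (by linarith) (by linarith)
        have h3 := hf (a + n * δ) c (by linarith) (by linarith) hcb (by linarith)
        linarith [abs_sub_le (f a) (f (a + n * δ)) (f c)]
  have h0 : 0 ≤ (b - a) / δ := div_nonneg (by linarith) hδ.le
  have h1 := key ⌈(b - a) / δ⌉₊ b hab le_rfl (by
    rw [← div_le_iff₀ hδ]; exact Nat.le_ceil _)
  have h2 := (Nat.ceil_lt_add_one h0).le
  nlinarith

section Contracting

variable {X : Type*} [MetricSpace X]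

/-- The closest-point projection onto `σ` maps balls disjoint from `σ` to sets of uniformly bounded
diameter. -/
def IsContracting (σ : ℝ → X) (K : ℝ) : Prop :=
  ∀ x y, dist x y ≤ height σ x → |foot σ x - foot σ y| ≤ K

/-- The perpendicular c from x and the geodesic e from x to y are compared at equal times. While
they are close relative to the height, the weak hypothesis applies directly. Afterwards e is
followed in boundedly many steps that are short relative to its height, until it is near the end or
comes close to σ; in the latter case the monotone growth of dist (c s) (e s) bounds the remaining
length. -/
theorem IsHadamardSpace.isContracting_of_weak (hX : IsHadamardSpace X) {σ : ℝ → X}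
    (hσ : Isometry σ) {κ M : ℝ} (hκ : 0 < κ) (hκ1 : κ ≤ 1) (hM : 0 < M)
    (hw : ∀ x y, dist x y ≤ κ * height σ x → |foot σ x - foot σ y| ≤ M) :
    ∃ K, 0 ≤ K ∧ IsContracting σ K := by
  set η := κ ^ 2 / 4 with hη
  have hη0 : 0 < η := by positivity
  have hη1 : η ≤ 1 := by nlinarith
  set M₂ := M + M * (1 / (κ * η) + 1) with hM₂
  have hMM₂ : M ≤ M₂ := by
    rw [hM₂]
    linarith [show 0 ≤ M * (1 / (κ * η) + 1) by positivity]
  have hfrac : 0 ≤ 2 * M₂ / κ := by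
    have : 0 ≤ M₂ := by linarith
    positivity
  refine ⟨M₂ + M + 2 * M₂ / κ, by linarith, fun x y hxy => ?_⟩
  set A := height σ x with hA
  set d := dist x y with hd
  have hd0 : 0 ≤ d := dist_nonneg
  set p := foot σ x with hp
  obtain ⟨c, hc⟩ := hX.geodesic x (σ p)
  rw [show dist x (σ p) = A from rfl] at hc
  obtain ⟨e, he⟩ := hX.geodesic x y
  rw [← hd] at he
  have hcs : ∀ s ∈ Icc 0 A, foot σ (c s) = p ∧ height σ (c s) = A - s := by
    intro s hs
    have := hX.foot_of_between hσ (x := x) (w := c s) (by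
      rw [hc.dist_left hs, ← hp, hc.dist_right hs, ← hA]; ring)
    exact ⟨this.1, by rw [this.2, hc.dist_right hs]⟩
  have heh : ∀ s ∈ Icc 0 d, A - s ≤ height σ (e s) := by
    intro s hs
    have := height_sub_le hσ x (e s)
    rw [he.dist_left hs] at this
    linarith
  have hmono : ∀ s t, 0 ≤ s → s ≤ t → t ≤ d → dist (c s) (e s) ≤ dist (c t) (e t) := by
    intro s t hs hst ht
    rcases (hs.trans hst).eq_or_lt with h0 | h0
    · rw [show s = t by linarith]
    · have h1 := hX.dist_common_left_le (hc.sub le_rfl (hs.trans hst) (ht.trans hxy))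
        (he.sub le_rfl (hs.trans hst) ht |> fun h => by
          rwa [he.2.1, ← hc.2.1] at h) (t := s / t)
        ⟨div_nonneg hs h0.le, (div_le_one h0).2 hst⟩
      simp only [sub_zero, zero_add, div_mul_cancel₀ _ h0.ne'] at h1
      exact h1.trans (mul_le_of_le_one_left dist_nonneg ((div_le_one h0).2 hst))
  -- On this stretch the height of e is at least ηa', so each step of length κηa' moves the foot by
  -- at most M, and about 1/(κη) steps suffice.
  have hdrift : ∀ a' u v, 0 < a' → 0 ≤ u → u ≤ v → v ≤ d → v - u ≤ a' → v ≤ A - η * a' →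
      |foot σ (e u) - foot σ (e v)| ≤ M * (1 / (κ * η) + 1) := by
    intro a' u v ha' hu huv hv hl hvA
    have hpos : 0 < κ * (η * a') := by positivity
    have h1 := abs_sub_le_of_forall_short (f := fun s => foot σ (e s)) hpos hM.le huv (by
      intro s t hs hst ht hts
      apply hw
      rw [he.2.2.2 s ⟨by linarith, by linarith⟩ t ⟨by linarith, by linarith⟩, abs_sub_comm,
        abs_of_nonneg (by linarith)]
      refine hts.trans (mul_le_mul_of_nonneg_left ?_ hκ.le)
      linarith [heh s ⟨by linarith, by linarith⟩])
    refine h1.trans (mul_le_mul_of_nonneg_left ?_ hM.le)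
    have : (v - u) / (κ * (η * a')) ≤ 1 / (κ * η) := by
      rw [div_le_div_iff₀ hpos (by positivity)]
      nlinarith [mul_pos hκ hη0]
    linarith
  by_cases hcase : dist (c d) (e d) ≤ κ * (A - d)
  · have h1 := hcs d ⟨hd0, hxy⟩
    have h2 := hw (c d) (e d) (by rwa [h1.2])
    rw [h1.1, he.2.2.1] at h2
    linarith
  push Not at hcase
  have hcont : ContinuousOn (fun s => κ * (A - s) - dist (c s) (e s)) (Icc 0 d) := by
    refine ContinuousOn.sub (by fun_prop) (continuous_dist.comp_continuousOn
      (ContinuousOn.prodMk (hc.continuousOn.mono (Icc_subset_Icc le_rfl hxy)) he.continuousOn))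
  -- At time u the distance from c to e is exactly κ times the height of c: the weak hypothesis
  -- still applies, and the two geodesics have already diverged by κa'.
  obtain ⟨u, hu, hu0⟩ := intermediate_value_Icc' hd0 hcont (show (0 : ℝ) ∈ _ by
    constructor
    · linarith
    · simp only [hc.2.1, he.2.1, dist_self]
      have : 0 ≤ κ * A := mul_nonneg hκ.le (height_nonneg σ x)
      linarith)
  simp only at hu0
  have hud : u < d := by
    refine lt_of_le_of_ne hu.2 fun h => ?_
    rw [h] at hu0
    linarith
  have huA : u ∈ Icc 0 A := ⟨hu.1, by linarith⟩
  have h1 : |p - foot σ (e u)| ≤ M := by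
    have := hw (c u) (e u) (by rw [(hcs u huA).2]; linarith)
    rwa [(hcs u huA).1] at this
  set a' := A - u with ha'
  have ha0 : 0 < a' := by linarith
  have hfy : foot σ y = foot σ (e d) := by rw [he.2.2.1]
  rcases le_or_gt d (A - η * a') with hs1 | hs1
  · have h2 := hdrift a' u d ha0 hu.1 hud.le le_rfl (by linarith) hs1
    rw [hfy]
    linarith [abs_sub_le p (foot σ (e u)) (foot σ (e d))]
  set s₁ := A - η * a' with hs₁
  have hus : u ≤ s₁ := by nlinarith
  have h2 := hdrift a' u s₁ ha0 hu.1 hus hs1.le (by nlinarith) le_rfl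
  have h3 : |p - foot σ (e s₁)| ≤ M₂ := by
    linarith [abs_sub_le p (foot σ (e u)) (foot σ (e s₁))]
  have hs₁mem : s₁ ∈ Icc 0 d := ⟨hu.1.trans hus, hs1.le⟩
  rcases le_or_gt (d - s₁) (κ * height σ (e s₁)) with hk | hk
  · have h4 := hw (e s₁) y (by rwa [he.dist_right hs₁mem])
    linarith [abs_sub_le p (foot σ (e s₁)) (foot σ y)]
  -- Here e s₁ is low above σ with foot within M₂ of p, so c s₁ and e s₁ are close, although their
  -- distance is at least κa'. With η = κ²/4 this forces a' ≤ 2M₂/κ, and the foot moves by at most d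
  -- - u ≤ a' after time u.
  · have hcs₁ := hcs s₁ ⟨hs₁mem.1, by linarith⟩
    have h4 : dist (c s₁) (e s₁) ≤ η * a' + M₂ + height σ (e s₁) := by
      have e1 : dist (c s₁) (σ p) = η * a' := by
        rw [hc.dist_right ⟨hs₁mem.1, by linarith⟩]; ring
      have e2 : dist (σ p) (σ (foot σ (e s₁))) ≤ M₂ := by
        rw [hσ.dist_eq, Real.dist_eq]; exact h3
      have e3 := dist_triangle4 (c s₁) (σ p) (σ (foot σ (e s₁))) (e s₁)
      rw [dist_comm (σ (foot σ (e s₁))) (e s₁)] at e3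
      change _ ≤ _ + height σ (e s₁) at e3
      linarith
    have h5 := hmono u s₁ hu.1 hus hs1.le
    have h6 : κ * a' ≤ η * a' + M₂ + height σ (e s₁) := by linarith
    have h7 : κ * height σ (e s₁) ≤ η * a' := by linarith
    have h8 : κ * (κ * a') ≤ κ * (η * a') + κ * M₂ + η * a' := by nlinarith
    have h9 : κ * (η * a') ≤ η * a' := mul_le_of_le_one_left (by positivity) hκ1
    have h10 : κ * a' ≤ 2 * M₂ := by
      have : κ * (κ * a') ≤ κ * (2 * M₂) := by
        have : η * a' = κ * (κ * a') / 4 := by rw [hη]; ring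
        linarith
      exact le_of_mul_le_mul_left this hκ
    have h11 : a' ≤ 2 * M₂ / κ := by rw [le_div_iff₀ hκ]; linarith
    have h12 := hX.abs_foot_sub_le hσ (e u) y
    rw [he.dist_right hu] at h12
    linarith [abs_sub_le p (foot σ (e u)) (foot σ y)]

theorem IsRankOne.exists_contracting_axis [LocallyCompactSpace X] (hX : IsHadamardSpace X)
    {h : X ≃ᵢ X} (hh : IsRankOne h) :
    ∃ (σ : ℝ → X) (l K : ℝ), IsAxis h σ l ∧ ¬ BoundsFlatHalfPlane σ ∧ 0 ≤ K ∧
      IsContracting σ K := by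
  have := hX.properSpace
  obtain ⟨σ, l, hax, hb⟩ := hh
  obtain ⟨κ, hκ, M, hM, hκ1, hw⟩ := hX.exists_weak_contraction hax hb
  obtain ⟨K, hK, hc⟩ := hX.isContracting_of_weak hax.2.1 hκ hκ1 hM hw
  exact ⟨σ, l, K, hax, hb, hK, hc⟩

variable {σ : ℝ → X} {K : ℝ}

theorem IsContracting.comp_neg (hX : IsHadamardSpace X) (hσ : Isometry σ)
    (hK : IsContracting σ K) : IsContracting (fun t => σ (-t)) K := by
  intro x y hxy
  rw [hX.height_comp_neg hσ] at hxy
  rw [hX.foot_comp_neg hσ, hX.foot_comp_neg hσ, ← abs_neg]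
  convert hK x y hxy using 2
  ring

/-- Geodesics whose endpoints have far apart feet run close to a contracting line. -/
theorem IsContracting.exists_of_lt (hK : IsContracting σ K) {x y : X} (h : 2 * K < |foot σ x - foot σ y|) {τ : ℝ → X} {d : ℝ}
    (hτ : IsGeodesicPath τ d x y) :
    height σ x + height σ y ≤ d ∧ |foot σ x - foot σ (τ (height σ x))| ≤ K ∧
      |foot σ (τ (d - height σ y)) - foot σ y| ≤ K := by
  have hd := hτ.length_eq
  have hA := height_nonneg σ x
  have hB := height_nonneg σ y
  have hfirst : ∀ s ∈ Icc 0 d, s ≤ height σ x → |foot σ x - foot σ (τ s)| ≤ K := by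
    intro s hs hsx
    apply hK
    rwa [hτ.dist_left hs]
  have hlast : ∀ s ∈ Icc 0 d, d - s ≤ height σ y → |foot σ (τ s) - foot σ y| ≤ K := by
    intro s hs hsy
    rw [abs_sub_comm]
    apply hK
    rwa [dist_comm, hτ.dist_right hs]
  -- The balls about x and y with radii their heights project within K of the two feet. A common
  -- point on the geodesic would put the feet within 2K.
  have hle : height σ x + height σ y ≤ d := by
    by_contra hlt
    push Not at hlt
    have hmem : min (height σ x) d ∈ Icc 0 d := ⟨le_min hA hτ.1, min_le_right _ _⟩
    have h1 := hfirst _ hmem (min_le_left _ _)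
    have h2 := hlast _ hmem (by
      rcases min_cases (height σ x) d with ⟨h, _⟩ | ⟨h, _⟩ <;> rw [h] <;> linarith)
    linarith [abs_sub_le (foot σ x) (foot σ (τ (min (height σ x) d))) (foot σ y)]
  exact ⟨hle, hfirst _ ⟨hA, by linarith⟩ le_rfl, hlast _ ⟨by linarith, by linarith⟩ (by linarith)⟩

theorem IsContracting.le_dist (hX : IsHadamardSpace X) (hσ : Isometry σ)
    (hK : IsContracting σ K) {x y : X} (h : 2 * K < |foot σ x - foot σ y|) :
    height σ x + height σ y + |foot σ x - foot σ y| - 2 * K ≤ dist x y := by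
  obtain ⟨τ, hτ⟩ := hX.geodesic x y
  obtain ⟨h1, h2, h3⟩ := hK.exists_of_lt h hτ
  set w := τ (height σ x)
  set w' := τ (dist x y - height σ y)
  have h4 := hX.abs_foot_sub_le hσ w w'
  have h5 : dist w w' = dist x y - height σ y - height σ x := by
    rw [hτ.2.2.2 _ ⟨height_nonneg σ x, by linarith [height_nonneg σ y]⟩ _
      ⟨by linarith [height_nonneg σ x], by linarith [height_nonneg σ y]⟩, abs_sub_comm,
      abs_of_nonneg (by linarith)]
  linarith [abs_sub_le (foot σ x) (foot σ w) (foot σ y), abs_sub_le (foot σ w) (foot σ w') (foot σ y)]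

/-- Two lines with bounded projection: a point whose foot on `σ` is far out has bounded foot
on `τ`. -/
theorem IsContracting.abs_foot_le (hX : IsHadamardSpace X) (hσ : Isometry σ)
    (hK : IsContracting σ K) {τ : ℝ → X} (hτ : Isometry τ) {D : ℝ}
    (hD : ∀ t, |foot σ (τ t)| ≤ D) (h0 : dist (σ 0) (τ 0) ≤ D) {z : X}
    (hz : D + 2 * K < |foot σ z|) : |foot τ z| ≤ 2 * K + 4 * D := by
  set y := τ (foot τ z) with hy
  have h1 := hD (foot τ z)
  have h2 : |foot σ z| ≤ |foot σ z - foot σ y| + |foot σ y| := by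
    linarith [abs_sub_abs_le_abs_sub (foot σ z) (foot σ y)]
  have h3 := hK.le_dist hX hσ (x := z) (y := y) (by linarith)
  have h4 : dist z y ≤ height σ z + |foot σ z| + D := by
    have e1 : dist z y ≤ dist z (τ 0) := height_le hτ z 0
    have e2 := dist_triangle4 z (σ (foot σ z)) (σ 0) (τ 0)
    rw [hσ.dist_eq, Real.dist_eq, sub_zero] at e2
    change _ ≤ height σ z + _ + _ at e2
    linarith
  have h5 : |foot τ z| ≤ height σ y + |foot σ y| + D := by
    have e1 : dist y (τ 0) = |foot τ z| := by rw [hy, hτ.dist_eq, Real.dist_eq, sub_zero]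
    have e2 := dist_triangle4 y (σ (foot σ y)) (σ 0) (τ 0)
    rw [hσ.dist_eq, Real.dist_eq, sub_zero, e1] at e2
    change _ ≤ height σ y + _ + _ at e2
    linarith
  linarith

end Contracting

/-! ### Asymptotic rays and independence -/

section Asymptotic

variable {X : Type*} [MetricSpace X]

/-- Two rays are asymptotic if they stay at bounded distance. -/
def Asymptotic (ρ ρ' : ℝ → X) : Prop :=
  ∃ C, ∀ t, 0 ≤ t → dist (ρ t) (ρ' t) ≤ C

/-- One of the two rays of which the line `σ` consists. -/
def halfLine (σ : ℝ → X) (b : Bool) (t : ℝ) : X :=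
  σ (cond b t (-t))

theorem Asymptotic.symm {ρ ρ' : ℝ → X} (h : Asymptotic ρ ρ') : Asymptotic ρ' ρ := by
  obtain ⟨C, hC⟩ := h
  exact ⟨C, fun t ht => by rw [dist_comm]; exact hC t ht⟩

theorem Asymptotic.trans {ρ ρ' ρ'' : ℝ → X} (h : Asymptotic ρ ρ') (h' : Asymptotic ρ' ρ'') :
    Asymptotic ρ ρ'' := by
  obtain ⟨C, hC⟩ := h
  obtain ⟨C', hC'⟩ := h'
  exact ⟨C + C', fun t ht => (dist_triangle _ _ _).trans (add_le_add (hC t ht) (hC' t ht))⟩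

theorem Asymptotic.map {ρ ρ' : ℝ → X} (h : Asymptotic ρ ρ') (f : X ≃ᵢ X) :
    Asymptotic (fun t => f (ρ t)) (fun t => f (ρ' t)) := by
  obtain ⟨C, hC⟩ := h
  exact ⟨C, fun t ht => by rw [f.dist_eq]; exact hC t ht⟩

theorem Isometry.halfLine {σ : ℝ → X} (hσ : Isometry σ) (b : Bool) : Isometry (halfLine σ b) := by
  cases b
  · exact hσ.comp_neg
  · exact hσ

theorem IsHadamardSpace.asymptotic_of_frequently_nonneg (hX : IsHadamardSpace X) {σ τ : ℝ → X}
    (hσ : Isometry σ) (hτ : Isometry τ) {C : ℝ}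
    (h : ∀ T : ℝ, ∃ t u, T ≤ t ∧ 0 ≤ u ∧ dist (τ t) (σ u) ≤ C) : Asymptotic τ σ := by
  set d := dist (τ 0) (σ 0) with hd
  refine ⟨2 * C + d, fun s hs => ?_⟩
  obtain ⟨t, u, hst, hu, htu⟩ := h (max s 1)
  have ht1 : 0 < t := by linarith [le_max_right s 1]
  have hst' : s ≤ t := (le_max_left s 1).trans hst
  have hC : 0 ≤ C := dist_nonneg.trans htu
  have e1 : dist (τ t) (τ 0) = t := by rw [hτ.dist_eq, Real.dist_eq, sub_zero, abs_of_pos ht1]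
  have e2 : dist (σ u) (σ 0) = u := by rw [hσ.dist_eq, Real.dist_eq, sub_zero, abs_of_nonneg hu]
  have h1 : |u - t| ≤ C + d := by
    rw [abs_le]
    constructor
    · linarith [dist_triangle4 (τ t) (σ u) (σ 0) (τ 0), dist_comm (σ 0) (τ 0)]
    · linarith [dist_triangle4 (σ u) (τ t) (τ 0) (σ 0), dist_comm (σ u) (τ t)]
  have h2 : dist (τ t) (σ t) ≤ 2 * C + d := by
    have : dist (σ u) (σ t) = |u - t| := by rw [hσ.dist_eq, Real.dist_eq]
    linarith [dist_triangle (τ t) (σ u) (σ t)]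
  have hr0 : 0 ≤ s / t := div_nonneg hs ht1.le
  have hr1 : s / t ≤ 1 := (div_le_one ht1).2 hst'
  have h3 := hX.dist_geodesics_le (hτ.isGeodesicPath ht1.le) (hσ.isGeodesicPath ht1.le)
    ⟨hr0, hr1⟩
  simp only [sub_zero, zero_add, div_mul_cancel₀ _ ht1.ne'] at h3
  have h4 : (1 - s / t) * d ≤ (1 - s / t) * (2 * C + d) :=
    mul_le_mul_of_nonneg_left (by linarith) (by linarith)
  have h5 : s / t * dist (τ t) (σ t) ≤ s / t * (2 * C + d) := mul_le_mul_of_nonneg_left h2 hr0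
  linarith

theorem frequently_or_of_forall_exists {P Q : ℝ → Prop}
    (h : ∀ T : ℝ, ∃ t, T ≤ t ∧ (P t ∨ Q t)) :
    (∀ T : ℝ, ∃ t, T ≤ t ∧ P t) ∨ ∀ T : ℝ, ∃ t, T ≤ t ∧ Q t := by
  by_contra hcon
  push Not at hcon
  obtain ⟨⟨T, hT⟩, T', hT'⟩ := hcon
  obtain ⟨t, ht, hPQ⟩ := h (max T T')
  exact hPQ.elim (hT t ((le_max_left _ _).trans ht)) (hT' t ((le_max_right _ _).trans ht))

theorem IsHadamardSpace.exists_asymptotic_halfLine_of_frequently_ge (hX : IsHadamardSpace X)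
    {σ τ : ℝ → X} (hσ : Isometry σ) (hτ : Isometry τ) {C : ℝ}
    (h : ∀ T : ℝ, ∃ t, T ≤ t ∧ ∃ u, dist (τ t) (σ u) ≤ C) : ∃ b, Asymptotic τ (halfLine σ b) := by
  have h' : ∀ T : ℝ, ∃ t, T ≤ t ∧ ((∃ u, 0 ≤ u ∧ dist (τ t) (halfLine σ true u) ≤ C) ∨
      ∃ u, 0 ≤ u ∧ dist (τ t) (halfLine σ false u) ≤ C) := by
    intro T
    obtain ⟨t, ht, u, hu⟩ := h T
    refine ⟨t, ht, ?_⟩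
    rcases le_total 0 u with hu0 | hu0
    · exact Or.inl ⟨u, hu0, hu⟩
    · exact Or.inr ⟨-u, by linarith, by simpa [halfLine] using hu⟩
  rcases frequently_or_of_forall_exists h' with h1 | h1
  · refine ⟨true, hX.asymptotic_of_frequently_nonneg (hσ.halfLine _) hτ (C := C) fun T => ?_⟩
    obtain ⟨t, ht, u, hu⟩ := h1 T
    exact ⟨t, u, ht, hu⟩
  · refine ⟨false, hX.asymptotic_of_frequently_nonneg (hσ.halfLine _) hτ (C := C) fun T => ?_⟩
    obtain ⟨t, ht, u, hu⟩ := h1 T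
    exact ⟨t, u, ht, hu⟩

theorem IsHadamardSpace.exists_asymptotic_halfLines_of_frequently (hX : IsHadamardSpace X)
    {σ τ : ℝ → X} (hσ : Isometry σ) (hτ : Isometry τ) {C : ℝ}
    (h : ∀ T : ℝ, ∃ t u, T ≤ |t| ∧ dist (τ t) (σ u) ≤ C) :
    ∃ b b', Asymptotic (halfLine τ b) (halfLine σ b') := by
  have h' : ∀ T : ℝ, ∃ t, T ≤ t ∧ ((∃ u, dist (halfLine τ true t) (σ u) ≤ C) ∨
      ∃ u, dist (halfLine τ false t) (σ u) ≤ C) := by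
    intro T
    obtain ⟨t, u, ht, hu⟩ := h T
    rcases le_abs.1 ht with ht | ht
    · exact ⟨t, ht, Or.inl ⟨u, hu⟩⟩
    · exact ⟨-t, ht, Or.inr ⟨u, by simpa [halfLine] using hu⟩⟩
  rcases frequently_or_of_forall_exists h' with h1 | h1
  · exact ⟨true, hX.exists_asymptotic_halfLine_of_frequently_ge hσ (hτ.halfLine _) h1⟩
  · exact ⟨false, hX.exists_asymptotic_halfLine_of_frequently_ge hσ (hτ.halfLine _) h1⟩

/-- A line with no end in common with a contracting line has bounded projection to it. -/
theorem IsContracting.exists_abs_foot_line_le (hX : IsHadamardSpace X) {σ τ : ℝ → X} {K : ℝ}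
    (hσ : Isometry σ) (hτ : Isometry τ) (hK0 : 0 ≤ K) (hK : IsContracting σ K)
    (hend : ∀ b b', ¬ Asymptotic (halfLine τ b) (halfLine σ b')) :
    ∃ D, ∀ t, |foot σ (τ t)| ≤ D := by
  by_contra hcon
  push Not at hcon
  have key : ∀ T : ℝ, ∃ t u, T ≤ |t| ∧ dist (τ t) (σ u) ≤ 4 * K := by
    intro T
    obtain ⟨s, hs⟩ := hcon (|T| + 5 * K + |foot σ (τ 0)|)
    set x := τ 0 with hx
    set y := τ s with hy
    have hfar : |T| + 5 * K < |foot σ x - foot σ y| := by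
      linarith [abs_sub_abs_le_abs_sub (foot σ y) (foot σ x), abs_sub_comm (foot σ x) (foot σ y)]
    have hT := abs_nonneg T
    have hge : ∃ ω : ℝ → ℝ, (∀ u, |ω u| = |u|) ∧
        IsGeodesicPath (fun u => τ (ω u)) |s| x y := by
      rcases le_total 0 s with h0 | h0
      · refine ⟨id, fun u => rfl, ?_⟩
        have := hτ.isGeodesicPath h0
        simpa [abs_of_nonneg h0] using this
      · refine ⟨fun u => -u, abs_neg, ?_⟩
        have := hτ.comp_neg.isGeodesicPath (a := 0) (b := -s) (by linarith)
        simpa [abs_of_nonpos h0] using this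
    obtain ⟨ω, hω, hg⟩ := hge
    obtain ⟨h1, h2, h3⟩ := hK.exists_of_lt (by linarith) hg
    -- The point w where the geodesic enters the closed ball about y of radius height σ y has its
    -- foot within K of that of y. The segment from x to w is then almost as long as the detour
    -- along σ allows, so w lies near σ.
    set v := |s| - height σ y with hv
    set w := τ (ω v) with hw
    have hA := height_nonneg σ x
    have hB := height_nonneg σ y
    have hvmem : v ∈ Icc 0 |s| := ⟨by linarith, by linarith⟩
    have h4 : |foot σ x - foot σ y| - K ≤ |foot σ x - foot σ w| := by
      linarith [abs_sub_le (foot σ x) (foot σ w) (foot σ y)]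
    have h5 := hK.le_dist hX hσ (x := x) (y := w) (by linarith)
    have h6 : dist x w = v := hg.dist_left hvmem
    have h7 : |s| ≤ height σ x + |foot σ x - foot σ y| + height σ y := by
      have e1 := dist_triangle4 x (σ (foot σ x)) (σ (foot σ y)) y
      rw [hσ.dist_eq, Real.dist_eq, ← hg.length_eq, dist_comm _ y] at e1
      exact e1
    refine ⟨ω v, foot σ w, ?_, ?_⟩
    · rw [hω, abs_of_nonneg hvmem.1]
      linarith [le_abs_self T, height_nonneg σ w]
    · change height σ w ≤ 4 * K
      linarith
  obtain ⟨b, b', h⟩ := hX.exists_asymptotic_halfLines_of_frequently hσ hτ key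
  exact hend b b' h

theorem IsAxis.asymptotic_zpow_halfLine {h : X ≃ᵢ X} {σ : ℝ → X} {l : ℝ} (H : IsAxis h σ l)
    (k : ℤ) (b : Bool) :
    Asymptotic (fun t => (h ^ k) (halfLine σ b t)) (halfLine σ b) := by
  refine ⟨|k * l|, fun t _ => ?_⟩
  simp only [halfLine]
  rw [H.zpow_apply, H.2.1.dist_eq, Real.dist_eq, add_sub_cancel_left]

/-- A ray whose end is fixed by a power of an isometry with contracting axis is asymptotic to this
axis. -/
theorem IsContracting.exists_asymptotic_of_zpow (hX : IsHadamardSpace X) {h : X ≃ᵢ X}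
    {σ τ : ℝ → X} {l K : ℝ} (H : IsAxis h σ l) (hK : IsContracting σ K) (hτ : Isometry τ) {k : ℤ}
    (hk : k ≠ 0) (hfix : Asymptotic (fun t => (h ^ k) (τ t)) τ) :
    ∃ b, Asymptotic τ (halfLine σ b) := by
  obtain ⟨hl, hσ, -⟩ := id H
  obtain ⟨D, hD⟩ := hfix
  have hj : ∀ (j : ℕ) (t : ℝ), 0 ≤ t → dist ((h ^ (k * j)) (τ t)) (τ t) ≤ j * D := by
    intro j t ht
    induction j with
    | zero => simp
    | succ j ih =>
      have e : h ^ (k * (j + 1 : ℕ)) = h ^ (k * j) * h ^ k := by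
        rw [← zpow_add]; congr 1; push_cast; ring
      rw [e, IsometryEquiv.mul_apply]
      have := dist_triangle ((h ^ (k * j)) ((h ^ k) (τ t))) ((h ^ (k * j)) (τ t)) (τ t)
      rw [(h ^ (k * (j : ℤ))).dist_eq] at this
      push_cast
      linarith [hD t ht]
  -- The power h ^ (k * j) moves feet by more than K but points of the ray by at most jD. By
  -- contraction no point of the ray is higher than jD above σ.
  obtain ⟨j, hjl⟩ := exists_nat_gt (K / l)
  rw [div_lt_iff₀ hl] at hjl
  have hbig : K < |((k * j : ℤ) : ℝ) * l| := by
    rw [abs_mul, abs_of_pos hl, Int.cast_mul, abs_mul, Int.cast_natCast, Nat.abs_cast]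
    have : (1 : ℝ) ≤ |(k : ℝ)| := by
      rw [← Int.cast_abs]; exact_mod_cast Int.one_le_abs hk
    have hj0 : (0 : ℝ) ≤ j * l := by positivity
    nlinarith
  refine hX.exists_asymptotic_halfLine_of_frequently_ge hσ hτ (C := j * D) fun T => ?_
  refine ⟨max T 0, le_max_left _ _, foot σ (τ (max T 0)), ?_⟩
  by_contra hlt
  push Not at hlt
  have h1 := hj j (max T 0) (le_max_right _ _)
  have h2 := hK (τ (max T 0)) ((h ^ (k * j)) (τ (max T 0))) (by
    rw [dist_comm]; exact h1.trans hlt.le)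
  rw [hX.foot_translate hσ _ (H.zpow_apply _), sub_add_cancel_left, abs_neg] at h2
  linarith

/-- Along a common end, the orbit points at g-exponent ±k and h-exponent ±⌊kl/m⌋ stay at bounded
distance for all k, which gives infinitely many pairs in a sublevel set. -/
theorem IndependentIsometries.not_asymptotic {g h : X ≃ᵢ X} {σ τ : ℝ → X} {l m : ℝ}
    (hgh : IndependentIsometries g h) (Hg : IsAxis g σ l) (Hh : IsAxis h τ m) (b b' : Bool) :
    ¬ Asymptotic (halfLine σ b) (halfLine τ b') := by
  rintro ⟨C, hC⟩
  obtain ⟨hl, hσ, -⟩ := id Hg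
  obtain ⟨hm, hτ, -⟩ := id Hh
  set d := dist (τ 0) (σ 0) with hd
  have hfin : {p : ℤ × ℤ | ¬ C + m + d + 1 ≤ dist ((g ^ p.1) (σ 0)) ((h ^ p.2) (σ 0))}.Finite :=
    tendsto_atTop.1 (hgh (σ 0)) (C + m + d + 1)
  refine Set.infinite_of_injective_forall_mem (f := fun k : ℕ =>
    ((cond b (k : ℤ) (-k), cond b' ⌊(k * l) / m⌋ (-⌊(k * l) / m⌋)) : ℤ × ℤ)) ?_ ?_ hfin
  · intro k k' hkk
    have := (Prod.ext_iff.1 hkk).1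
    cases b <;> simpa using this
  · intro k
    set n := ⌊(k * l) / m⌋ with hn
    have hn1 := Int.floor_le ((k * l) / m)
    have hn2 := (Int.lt_floor_add_one ((k * l) / m)).le
    rw [le_div_iff₀ hm, ← hn] at hn1
    rw [div_le_iff₀ hm, ← hn] at hn2
    have h1 : (g ^ (cond b (k : ℤ) (-k))) (σ 0) = halfLine σ b (k * l) := by
      rw [Hg.zpow_apply]; cases b <;> simp [halfLine]
    have h2 : (h ^ (cond b' n (-n))) (τ 0) = halfLine τ b' (n * m) := by
      rw [Hh.zpow_apply]; cases b' <;> simp [halfLine]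
    have h3 := hC (k * l) (by positivity)
    have h4 : dist (halfLine τ b' (k * l)) (halfLine τ b' (n * m)) ≤ m := by
      rw [(hτ.halfLine b').dist_eq, Real.dist_eq, abs_le]
      constructor <;> linarith
    have h5 : dist ((h ^ (cond b' n (-n))) (τ 0)) ((h ^ (cond b' n (-n))) (σ 0)) = d := by
      rw [(h ^ (cond b' n (-n))).dist_eq]
    rw [h2] at h5
    simp only [mem_ofPred_eq, not_le]
    rw [h1]
    linarith [dist_triangle4 (halfLine σ b (k * l)) (halfLine τ b' (k * l))
      (halfLine τ b' (n * m)) ((h ^ (cond b' n (-n))) (σ 0))]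

/-- An infinite sublevel set contains pairs with unbounded first exponent, since bounded first
exponents bound the second ones. The axes then come within a fixed distance of each other
arbitrarily far out and share an end. -/
theorem IsHadamardSpace.independentIsometries_of_not_asymptotic (hX : IsHadamardSpace X)
    {g h : X ≃ᵢ X} {σ τ : ℝ → X} {l m : ℝ} (Hg : IsAxis g σ l) (Hh : IsAxis h τ m)
    (hend : ∀ b b', ¬ Asymptotic (halfLine σ b) (halfLine τ b')) :
    IndependentIsometries g h := by
  obtain ⟨hl, hσ, -⟩ := id Hg
  obtain ⟨hm, hτ, -⟩ := id Hh
  intro x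
  refine tendsto_atTop.2 fun R => ?_
  by_contra hinf
  set S := {p : ℤ × ℤ | ¬ R ≤ dist ((g ^ p.1) x) ((h ^ p.2) x)} with hS
  have hSinf : S.Infinite := hinf
  set C := dist (σ 0) x + R + dist x (τ 0) with hC
  have hdist : ∀ p ∈ S, dist (σ (p.1 * l)) (τ (p.2 * m)) ≤ C := by
    intro p hp
    have h1 := Hg.zpow_apply p.1 0
    have h2 := Hh.zpow_apply p.2 0
    rw [zero_add] at h1 h2
    rw [← h1, ← h2]
    have h3 := dist_triangle4 ((g ^ p.1) (σ 0)) ((g ^ p.1) x) ((h ^ p.2) x) ((h ^ p.2) (τ 0))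
    rw [(g ^ p.1).dist_eq, (h ^ p.2).dist_eq] at h3
    linarith [not_le.1 (show ¬ R ≤ dist ((g ^ p.1) x) ((h ^ p.2) x) from hp)]
  have hbox : ∀ (c T : ℝ), 0 < c → {k : ℤ | |(k : ℝ) * c| ≤ T}.Finite := by
    intro c T hc
    refine (Set.finite_Icc (-⌈T / c⌉) ⌈T / c⌉).subset fun k hk => ?_
    have hk' : |(k : ℝ) * c| ≤ T := hk
    rw [abs_mul, abs_of_pos hc, ← le_div_iff₀ hc] at hk'
    have h1 := abs_le.1 (hk'.trans (Int.le_ceil _))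
    constructor
    · have := h1.1; exact_mod_cast this
    · have := h1.2; exact_mod_cast this
  have key : ∀ T : ℝ, ∃ t u, T ≤ |t| ∧ dist (σ t) (τ u) ≤ C := by
    intro T
    by_contra hcon
    push Not at hcon
    refine hSinf (((hbox l T hl).prod
      (hbox m (T + C + dist (σ 0) (τ 0)) hm)).subset fun p hp => ?_)
    have h1 := hdist p hp
    have h2 : |(p.1 : ℝ) * l| ≤ T := by
      by_contra h
      exact absurd h1 (not_le.2 (hcon _ _ (not_le.1 h).le))
    refine ⟨h2, ?_⟩
    have h3 := dist_triangle4 (τ (p.2 * m)) (σ (p.1 * l)) (σ 0) (τ 0)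
    rw [hτ.dist_eq, hσ.dist_eq, Real.dist_eq, Real.dist_eq, sub_zero, sub_zero,
      dist_comm (τ _)] at h3
    change |(p.2 : ℝ) * m| ≤ _
    linarith
  obtain ⟨b, b', h⟩ := hX.exists_asymptotic_halfLines_of_frequently hτ hσ key
  exact hend b b' h

end Asymptotic

section Separation

variable {ι : Type*} [Finite ι] {X : ι → Type*} [∀ i, MetricSpace (X i)]

/-- Given independent isometries `g`, `h` with contracting axes in each factor, some product
`g ^ n * h ^ m` moves both ends of the lines `σ i` away from these ends. -/
theorem exists_separating_zpow_mul_zpow (hX : ∀ i, IsHadamardSpace (X i))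
    {g h : ∀ i, X i ≃ᵢ X i} {α β σ : ∀ i, ℝ → X i} {l m K K' : ι → ℝ}
    (Hg : ∀ i, IsAxis (g i) (α i) (l i)) (Hh : ∀ i, IsAxis (h i) (β i) (m i))
    (hα : ∀ i, IsContracting (α i) (K i)) (hβ : ∀ i, IsContracting (β i) (K' i))
    (hgh : ∀ i, IndependentIsometries (g i) (h i)) (hσ : ∀ i, Isometry (σ i)) :
    ∃ n k : ℤ, ∀ i b b', ¬ Asymptotic
      (fun t => (g i ^ n * h i ^ k) (halfLine (σ i) b t)) (halfLine (σ i) b') := by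
  have cancel : ∀ {i : ι} {f : X i ≃ᵢ X i} {ρ ρ' : ℝ → X i} {n n' : ℤ},
      Asymptotic (fun t => (f ^ n) (ρ t)) ρ' → Asymptotic (fun t => (f ^ n') (ρ t)) ρ' →
      Asymptotic (fun t => (f ^ (n' - n)) (ρ t)) ρ := by
    intro i f ρ ρ' n n' h1 h2
    have h3 := (h2.trans h1.symm).map (f ^ (-n))
    have e1 : ∀ t, (f ^ (-n)) ((f ^ n') (ρ t)) = (f ^ (n' - n)) (ρ t) := by
      intro t
      rw [← IsometryEquiv.mul_apply, ← zpow_add, neg_add_eq_sub]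
    have e2 : ∀ t, (f ^ (-n)) ((f ^ n) (ρ t)) = ρ t := by
      intro t
      rw [← IsometryEquiv.mul_apply, ← zpow_add, neg_add_cancel, zpow_zero]
      rfl
    simpa only [e1, e2] using h3
  have choice : ∀ S : ι × Bool × Bool → Set ℤ, (∀ q, (S q).Subsingleton) → ∃ n, ∀ q, n ∉ S q := by
    intro S hS
    obtain ⟨n, hn⟩ := (Set.finite_iUnion fun q => (hS q).finite).infinite_compl.nonempty
    exact ⟨n, fun q hq => hn (mem_iUnion.2 ⟨q, hq⟩)⟩
  -- Ends of σ that are ends of β are fixed by every power of h, so n must handle them. Two bad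
  -- values of n for one pair of ends would make a nonzero power of g fix such an end, so α and β
  -- would share it.
  obtain ⟨n, hn⟩ := choice (fun q => {n | (∃ c, Asymptotic (halfLine (σ q.1) q.2.1)
      (halfLine (β q.1) c)) ∧ Asymptotic (fun t => (g q.1 ^ n) (halfLine (σ q.1) q.2.1 t))
      (halfLine (σ q.1) q.2.2)}) (by
    rintro ⟨i, b, b'⟩ n ⟨⟨c, hc⟩, hn⟩ n' ⟨-, hn'⟩
    by_contra hne
    obtain ⟨a, ha⟩ := (hα i).exists_asymptotic_of_zpow (hX i) (Hg i) ((hσ i).halfLine b)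
      (sub_ne_zero.2 (Ne.symm hne)) (cancel hn hn')
    exact (hgh i).not_asymptotic (Hg i) (Hh i) a c (ha.symm.trans hc))
  -- For the other ends, two bad values of k would make a nonzero power of h fix an end of σ that is
  -- not an end of β.
  obtain ⟨k, hk⟩ := choice (fun q => {k | (¬ ∃ c, Asymptotic (halfLine (σ q.1) q.2.1)
      (halfLine (β q.1) c)) ∧ Asymptotic
        (fun t => (g q.1 ^ n) ((h q.1 ^ k) (halfLine (σ q.1) q.2.1 t)))
      (halfLine (σ q.1) q.2.2)}) (by
    rintro ⟨i, b, b'⟩ k ⟨hc, hk⟩ k' ⟨-, hk'⟩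
    by_contra hne
    have hmove : ∀ {k : ℤ}, Asymptotic (fun t => (g i ^ n) ((h i ^ k) (halfLine (σ i) b t)))
        (halfLine (σ i) b') → Asymptotic (fun t => (h i ^ k) (halfLine (σ i) b t))
          (fun t => (g i ^ (-n)) (halfLine (σ i) b' t)) := by
      intro k hk
      have := hk.map (g i ^ (-n))
      have e : ∀ x, (g i ^ (-n)) ((g i ^ n) x) = x := by
        intro x
        rw [← IsometryEquiv.mul_apply, ← zpow_add, neg_add_cancel, zpow_zero]
        rfl
      simpa only [e] using this
    exact hc ((hβ i).exists_asymptotic_of_zpow (hX i) (Hh i) ((hσ i).halfLine b)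
      (sub_ne_zero.2 (Ne.symm hne)) (cancel (hmove hk) (hmove hk'))))
  refine ⟨n, k, fun i b b' hcon => ?_⟩
  simp only [IsometryEquiv.mul_apply] at hcon
  by_cases hc : ∃ c, Asymptotic (halfLine (σ i) b) (halfLine (β i) c)
  · refine hn (i, b, b') ⟨hc, ?_⟩
    obtain ⟨c, hc⟩ := hc
    have h1 : Asymptotic (fun t => (h i ^ k) (halfLine (σ i) b t)) (halfLine (σ i) b) :=
      ((hc.map (h i ^ k)).trans ((Hh i).asymptotic_zpow_halfLine k c)).trans hc.symm
    exact (h1.map (g i ^ n)).symm.trans hcon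
  · exact hk (i, b, b') ⟨hc, hcon⟩

end Separation

/-! ### Ping-pong along two contracting lines -/

section PingPong

variable {X : Type*} [MetricSpace X]

/-- Two `K`-contracting lines with projections to each other bounded by `D`. -/
structure IsPingPongPair (τ : Fin 2 → ℝ → X) (K D : ℝ) : Prop where
  isometry : ∀ j, Isometry (τ j)
  nonneg : 0 ≤ K
  contracting : ∀ j, IsContracting (τ j) K
  abs_foot_le : ∀ j k, j ≠ k → ∀ t, |foot (τ j) (τ k t)| ≤ D
  dist_le : ∀ j k, dist (τ j 0) (τ k 0) ≤ D

/-- The isometry given by a word in two isometries and their inverses. -/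
def wordIsometry (s : Fin 2 → X ≃ᵢ X) (w : List (Fin 2 × Bool)) : X ≃ᵢ X :=
  (w.map fun a => cond a.2 (s a.1) (s a.1)⁻¹).prod

theorem wordIsometry_cons (s : Fin 2 → X ≃ᵢ X) (a : Fin 2 × Bool) (w : List (Fin 2 × Bool)) :
    wordIsometry s (a :: w) = cond a.2 (s a.1) (s a.1)⁻¹ * wordIsometry s w := by
  simp [wordIsometry]

theorem lift_mk_eq_wordIsometry (s : Fin 2 → X ≃ᵢ X) (w : List (Fin 2 × Bool)) :
    FreeGroup.lift s (FreeGroup.mk w) = wordIsometry s w := by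
  rw [FreeGroup.lift_mk, wordIsometry]

theorem IsHadamardSpace.abs_foot_halfLine (hX : IsHadamardSpace X) {σ : ℝ → X} (hσ : Isometry σ)
    (b : Bool) (x : X) : |foot (halfLine σ b) x| = |foot σ x| := by
  cases b
  · change |foot (fun t => σ (-t)) x| = _
    rw [hX.foot_comp_neg hσ, abs_neg]
  · rfl

theorem IsContracting.isContracting_halfLine (hX : IsHadamardSpace X) {σ : ℝ → X} {K : ℝ} (hσ : Isometry σ)
    (hK : IsContracting σ K) (b : Bool) : IsContracting (halfLine σ b) K := by
  cases b
  · exact hK.comp_neg hX hσ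
  · exact hK

variable {τ : Fin 2 → ℝ → X} {K D L : ℝ} {s : Fin 2 → X ≃ᵢ X}

theorem letter_translate (hs : ∀ j t, s j (τ j t) = τ j (t + L)) (a : Fin 2 × Bool) (t : ℝ) :
    (cond a.2 (s a.1) (s a.1)⁻¹) (halfLine (τ a.1) a.2 t) = halfLine (τ a.1) a.2 (t + L) := by
  obtain ⟨j, b⟩ := a
  cases b
  · change (s j)⁻¹ (τ j (-t)) = τ j (-(t + L))
    rw [show -t = -(t + L) + L by ring, ← hs, IsometryEquiv.inv_apply_self]
  · exact hs j t

namespace IsPingPongPair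

variable (hX : IsHadamardSpace X) (H : IsPingPongPair τ K D)
  (hs : ∀ j t, s j (τ j t) = τ j (t + L))
include H

theorem bound_nonneg : 0 ≤ D := dist_nonneg.trans (H.dist_le 0 0)

include hs

theorem dist_word_le (hL : 0 ≤ L) (w : List (Fin 2 × Bool)) :
    dist (τ 0 0) (wordIsometry s w (τ 0 0)) ≤ w.length * (L + 10 * (K + D)) := by
  have hK := H.nonneg
  have hD := H.bound_nonneg
  induction w with
  | nil => simp [wordIsometry]
  | cons a w ih =>
    rw [wordIsometry_cons, IsometryEquiv.mul_apply]
    set z := wordIsometry s w (τ 0 0)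
    set e := cond a.2 (s a.1) (s a.1)⁻¹
    set ρ := halfLine (τ a.1) a.2 with hρ
    have hρi : Isometry ρ := (H.isometry a.1).halfLine a.2
    have hρ0 : dist (τ 0 0) (ρ 0) ≤ D := by
      have : ρ 0 = τ a.1 0 := by cases h : a.2 <;> simp [hρ, halfLine, h]
      rw [this]; exact H.dist_le _ _
    have h1 : dist (ρ 0) (e (ρ 0)) = L := by
      rw [letter_translate hs a, hρi.dist_eq, Real.dist_eq, zero_add, zero_sub, abs_neg,
        abs_of_nonneg hL]
    have h2 : dist (e (ρ 0)) (e z) ≤ D + dist (τ 0 0) z := by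
      rw [e.dist_eq]
      linarith [dist_triangle (ρ 0) (τ 0 0) z, dist_comm (ρ 0) (τ 0 0)]
    rw [List.length_cons]
    push_cast
    linarith [dist_triangle4 (τ 0 0) (ρ 0) (e (ρ 0)) (e z)]

include hX

/-- This is the ping-pong invariant: the letter applied next never pushes the orbit point back along
its axis by more than a constant. If the previous letter uses the same generator, reducedness makes
the directions agree; otherwise that letter moved the point far out along the other axis, so its
foot here is bounded by `abs_foot_le`. -/
theorem neg_le_foot (hL : 4 * K + 5 * D < L) (a : Fin 2 × Bool) (w : List (Fin 2 × Bool))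
    (hw : FreeGroup.IsReduced (a :: w)) :
    -(2 * K + 4 * D) ≤ foot (halfLine (τ a.1) a.2) (wordIsometry s w (τ 0 0)) := by
  have hK := H.nonneg
  have hD := H.bound_nonneg
  induction w generalizing a with
  | nil =>
    have h0 : |foot (τ a.1) (τ 0 0)| ≤ D := by
      by_cases h : a.1 = 0
      · rw [h, hX.foot_line (H.isometry 0), abs_zero]; exact hD
      · exact H.abs_foot_le _ _ h 0
    rw [← hX.abs_foot_halfLine (H.isometry _) a.2] at h0
    change _ ≤ foot (halfLine (τ a.1) a.2) (τ 0 0)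
    linarith [(abs_le.1 h0).1]
  | cons b w ih =>
    rw [FreeGroup.isReduced_cons_cons] at hw
    have h1 := ih b hw.2
    rw [wordIsometry_cons, IsometryEquiv.mul_apply]
    set z := wordIsometry s w (τ 0 0)
    have h2 := hX.foot_translate ((H.isometry b.1).halfLine b.2) _ (letter_translate hs b) z
    set z' := (cond b.2 (s b.1) (s b.1)⁻¹) z
    by_cases hab : a.1 = b.1
    · rw [show a = b from Prod.ext hab (hw.1 hab), h2]
      linarith
    · have h3 := (H.contracting b.1).abs_foot_le hX (H.isometry b.1) (H.isometry a.1)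
        (H.abs_foot_le _ _ (Ne.symm hab)) (H.dist_le _ _) (z := z') (by
          rw [← hX.abs_foot_halfLine (H.isometry _) b.2]
          linarith [le_abs_self (foot (halfLine (τ b.1) b.2) z')])
      rw [← hX.abs_foot_halfLine (H.isometry _) a.2] at h3
      exact (abs_le.1 h3).1

/-- A letter keeps the height over its axis and raises the foot by L, starting from a foot that is
not very negative. Passing through the axis gives almost all of L as a gain in distance, with loss
at most 6K + 10D. -/
theorem le_dist_word (hL : 4 * K + 5 * D < L) (w : List (Fin 2 × Bool))
    (hw : FreeGroup.IsReduced w) :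
    w.length * (L - 10 * (K + D)) ≤ dist (τ 0 0) (wordIsometry s w (τ 0 0)) := by
  have hK := H.nonneg
  have hD := H.bound_nonneg
  induction w with
  | nil => simp
  | cons a w ih =>
    have h1 := ih (hw.infix ⟨[a], [], by simp⟩)
    have h2 := H.neg_le_foot hX hs hL a w hw
    rw [wordIsometry_cons, IsometryEquiv.mul_apply]
    set z := wordIsometry s w (τ 0 0)
    set e := cond a.2 (s a.1) (s a.1)⁻¹
    set ρ := halfLine (τ a.1) a.2 with hρ
    have hρi : Isometry ρ := (H.isometry a.1).halfLine a.2
    have hρ0 : dist (τ 0 0) (ρ 0) ≤ D := by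
      have : ρ 0 = τ a.1 0 := by cases h : a.2 <;> simp [hρ, halfLine, h]
      rw [this]; exact H.dist_le _ _
    have h3 : foot ρ (e z) = foot ρ z + L := hX.foot_translate hρi _ (letter_translate hs a) z
    have h4 : height ρ (e z) = height ρ z := hX.height_translate hρi _ (letter_translate hs a) z
    have h5 := ((H.contracting a.1).isContracting_halfLine hX (H.isometry a.1) a.2).le_dist hX hρi
      (x := e z) (y := ρ 0)
    rw [hX.foot_line hρi, hX.height_line hρi, sub_zero, add_zero, h3, h4,
      abs_of_nonneg (by linarith)] at h5
    have h6 := h5 (by linarith)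
    have h7 : dist (τ 0 0) z ≤ D + |foot ρ z| + height ρ z := by
      have := dist_triangle4 (τ 0 0) (ρ 0) (ρ (foot ρ z)) z
      rw [hρi.dist_eq, Real.dist_eq, zero_sub, abs_neg, dist_comm (ρ _) z] at this
      change _ ≤ _ + height ρ z at this
      linarith
    have h8 : |foot ρ z| ≤ foot ρ z + 2 * (2 * K + 4 * D) := by
      rw [abs_le]; constructor <;> linarith
    rw [List.length_cons]
    push_cast
    linarith [dist_triangle (e z) (τ 0 0) (ρ 0), dist_comm (e z) (τ 0 0)]

theorem lift_injective (hL : 10 * (K + D) < L) : Function.Injective (FreeGroup.lift s) := by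
  have hK := H.nonneg
  have hD := H.bound_nonneg
  refine (injective_iff_map_eq_one _).2 fun u hu => ?_
  have h1 := H.le_dist_word hX hs (by linarith) u.toWord FreeGroup.isReduced_toWord
  rw [← lift_mk_eq_wordIsometry, FreeGroup.mk_toWord, hu, show (1 : X ≃ᵢ X) (τ 0 0) = τ 0 0 from rfl,
    dist_self] at h1
  rw [← FreeGroup.toWord_eq_nil_iff, ← List.length_eq_zero_iff]
  by_contra h
  have h2 : (0 : ℝ) < u.toWord.length := by exact_mod_cast Nat.pos_of_ne_zero h
  nlinarith

end IsPingPongPair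

theorem IsAxis.conj {h : X ≃ᵢ X} {σ : ℝ → X} {l : ℝ} (H : IsAxis h σ l) (f : X ≃ᵢ X) :
    IsAxis (f * h * f⁻¹) (fun t => f (σ t)) l := by
  refine ⟨H.1, f.isometry.comp H.2.1, fun t => ?_⟩
  rw [IsometryEquiv.mul_apply, IsometryEquiv.mul_apply, IsometryEquiv.inv_apply_self, H.2.2]

theorem IsAxis.abs_dist_pow_sub_le {h : X ≃ᵢ X} {σ : ℝ → X} {l : ℝ} (H : IsAxis h σ l) (x : X)
    (n : ℕ) : |dist x ((h ^ n) x) - n * l| ≤ 2 * dist x (σ 0) := by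
  have h1 := H.zpow_apply n 0
  rw [zpow_natCast, zero_add, Int.cast_natCast] at h1
  have h2 : dist (σ 0) ((h ^ n) (σ 0)) = n * l := by
    rw [h1, H.2.1.dist_eq, Real.dist_eq, zero_sub, abs_neg,
      abs_of_nonneg (mul_nonneg n.cast_nonneg H.1.le)]
  have h3 : dist ((h ^ n) x) ((h ^ n) (σ 0)) = dist x (σ 0) := (h ^ n).dist_eq _ _
  rw [← h2, abs_le]
  constructor
  · linarith [dist_triangle4 (σ 0) x ((h ^ n) x) ((h ^ n) (σ 0)), dist_comm (σ 0) x]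
  · linarith [dist_triangle4 x (σ 0) ((h ^ n) (σ 0)) ((h ^ n) x),
      dist_comm ((h ^ n) (σ 0)) ((h ^ n) x)]

theorem le_of_forall_nat_mul_sub_le {p q c : ℝ} (h : ∀ n : ℕ, n * (p - q) ≤ c) : p ≤ q := by
  by_contra hlt
  push Not at hlt
  obtain ⟨n, hn⟩ := exists_nat_gt (c / (p - q))
  rw [div_lt_iff₀ (by linarith)] at hn
  linarith [h n]

/-- The translation length of an element of a ping-pong group is proportional to the length of its
cyclically reduced word, up to a small relative error. -/
theorem IsPingPongPair.translation_bounds (hX : IsHadamardSpace X) (H : IsPingPongPair τ K D)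
    (hs : ∀ j t, s j (τ j t) = τ j (t + L)) (hL : 10 * (K + D) < L) (u : FreeGroup (Fin 2))
    {ρ : ℝ → X} {l : ℝ} (hu : IsAxis (FreeGroup.lift s u) ρ l) :
    (FreeGroup.reduceCyclically u.toWord).length * (L - 10 * (K + D)) ≤ l ∧
      l ≤ (FreeGroup.reduceCyclically u.toWord).length * (L + 10 * (K + D)) := by
  have hK := H.nonneg
  have hD := H.bound_nonneg
  set c := FreeGroup.reduceCyclically u.toWord
  set v := FreeGroup.lift s (FreeGroup.mk (FreeGroup.reduceCyclically.conjugator u.toWord)) with hv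
  have hcr : FreeGroup.IsCyclicallyReduced c :=
    FreeGroup.reduceCyclically.isCyclicallyReduced FreeGroup.isReduced_toWord
  have huc : FreeGroup.lift s u = v * wordIsometry s c * v⁻¹ := by
    conv_lhs => rw [← FreeGroup.mk_toWord (x := u),
      ← FreeGroup.reduceCyclically.conj_conjugator_reduceCyclically u.toWord]
    rw [hv, ← lift_mk_eq_wordIsometry, ← map_inv, ← map_mul, ← map_mul, FreeGroup.inv_mk,
      FreeGroup.mul_mk, FreeGroup.mul_mk]
  have hc : IsAxis (wordIsometry s c) (fun t => v⁻¹ (ρ t)) l := by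
    have := hu.conj v⁻¹
    rwa [huc, show v⁻¹ * (v * wordIsometry s c * v⁻¹) * v⁻¹⁻¹ = wordIsometry s c by group] at this
  -- Powers of a cyclically reduced word are reduced by concatenation alone, so the word estimates
  -- apply to c ^ n with length n times that of c. Comparison with displacement nl + O(1) for all n
  -- removes the additive constant.
  have hpow : ∀ n : ℕ, wordIsometry s (List.replicate n c).flatten = wordIsometry s c ^ n := by
    intro n
    induction n with
    | zero => simp [wordIsometry]
    | succ n ih =>
      rw [pow_succ', ← ih, List.replicate_succ, List.flatten_cons]
      simp [wordIsometry]
  have hlen : ∀ n : ℕ, ((List.replicate n c).flatten.length : ℝ) = n * c.length := by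
    intro n
    simp
  have hdist := hc.abs_dist_pow_sub_le (τ 0 0)
  constructor
  · refine le_of_forall_nat_mul_sub_le (c := 2 * dist (τ 0 0) (v⁻¹ (ρ 0))) fun n => ?_
    have h1 := H.le_dist_word hX hs (by linarith) _ (hcr.flatten_replicate n).isReduced
    rw [hlen, hpow] at h1
    linarith [(abs_le.1 (hdist n)).2]
  · refine le_of_forall_nat_mul_sub_le (c := 2 * dist (τ 0 0) (v⁻¹ (ρ 0))) fun n => ?_
    have h1 := H.dist_word_le hs (by linarith) (List.replicate n c).flatten
    rw [hlen, hpow] at h1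
    linarith [(abs_le.1 (hdist n)).1]

end PingPong

/-! ### Transport of axes -/

section Transport

variable {X : Type*} [MetricSpace X]

theorem IsAxis.pow {h : X ≃ᵢ X} {σ : ℝ → X} {l : ℝ} (H : IsAxis h σ l) {n : ℕ} (hn : 0 < n) :
    IsAxis (h ^ n) σ (n * l) := by
  refine ⟨mul_pos (by exact_mod_cast hn) H.1, H.2.1, fun t => ?_⟩
  have := H.zpow_apply n t
  rwa [zpow_natCast, Int.cast_natCast] at this

theorem BoundsFlatHalfPlane.map {σ : ℝ → X} (H : BoundsFlatHalfPlane σ) (f : X ≃ᵢ X) :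
    BoundsFlatHalfPlane fun t => f (σ t) := by
  obtain ⟨ι, hι, hcl, hconv, hσ⟩ := H
  have himg : (fun p => f (ι p)) '' (Ici 0 ×ˢ univ) = f '' (ι '' (Ici 0 ×ˢ univ)) :=
    (image_image _ _ _).symm
  refine ⟨fun p => f (ι p), fun p q hp hq => by rw [f.dist_eq]; exact hι p q hp hq, ?_, ?_,
    fun t => congrArg f (hσ t)⟩
  · rw [himg]
    exact f.toHomeomorph.isClosedMap _ hcl
  · rw [himg]
    rintro _ ⟨x, hx, rfl⟩ _ ⟨y, hy, rfl⟩ ω l hω t ht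
    refine ⟨f.symm (ω t), ?_, f.apply_symm_apply _⟩
    refine hconv x hx y hy (fun u => f.symm (ω u)) l ⟨hω.1, ?_, ?_, fun u hu v hv => ?_⟩ t ht
    · simp only [hω.2.1, f.symm_apply_apply]
    · simp only [hω.2.2.1, f.symm_apply_apply]
    · rw [f.symm.dist_eq]; exact hω.2.2.2 u hu v hv

theorem not_boundsFlatHalfPlane_map {σ : ℝ → X} (H : ¬ BoundsFlatHalfPlane σ) (f : X ≃ᵢ X) :
    ¬ BoundsFlatHalfPlane fun t => f (σ t) := by
  intro h
  apply H
  have := h.map f.symm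
  simpa only [f.symm_apply_apply] using this

theorem IsHadamardSpace.foot_map (hX : IsHadamardSpace X) {σ : ℝ → X} (hσ : Isometry σ)
    (f : X ≃ᵢ X) (x : X) : foot (fun t => f (σ t)) (f x) = foot σ x := by
  refine hX.foot_eq (f.isometry.comp hσ) fun t => ?_
  rw [Function.comp_apply, Function.comp_apply, f.dist_eq, f.dist_eq]
  exact height_le hσ x t

theorem IsContracting.map (hX : IsHadamardSpace X) {σ : ℝ → X} {K : ℝ} (hσ : Isometry σ)
    (hK : IsContracting σ K) (f : X ≃ᵢ X) : IsContracting (fun t => f (σ t)) K := by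
  intro x y hxy
  obtain ⟨x, rfl⟩ := f.surjective x
  obtain ⟨y, rfl⟩ := f.surjective y
  rw [height, hX.foot_map hσ, f.dist_eq, f.dist_eq] at hxy
  rw [hX.foot_map hσ, hX.foot_map hσ]
  exact hK x y hxy

theorem IsContracting.exists_isPingPongPair (hX : IsHadamardSpace X) {σ : ℝ → X} {K : ℝ}
    (hσ : Isometry σ) (hK0 : 0 ≤ K) (hK : IsContracting σ K) (f : X ≃ᵢ X)
    (hend : ∀ b b', ¬ Asymptotic (fun t => f (halfLine σ b t)) (halfLine σ b')) :
    ∃ D, IsPingPongPair ![σ, fun t => f (σ t)] K D := by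
  have hfσ : Isometry fun t => f (σ t) := f.isometry.comp hσ
  have hfK := hK.map hX hσ f
  obtain ⟨D₁, h1⟩ := hK.exists_abs_foot_line_le hX hσ hfσ hK0 hend
  obtain ⟨D₂, h2⟩ := hfK.exists_abs_foot_line_le hX hfσ hσ hK0 fun b b' h => hend b' b h.symm
  set d := dist (σ 0) (f (σ 0)) with hd
  refine ⟨max (max D₁ D₂) d, ?_, hK0, ?_, ?_, ?_⟩
  · intro j; fin_cases j
    · exact hσ
    · exact hfσ
  · intro j; fin_cases j
    · exact hK
    · exact hfK
  · intro j k hjk t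
    fin_cases j <;> fin_cases k <;> simp at hjk ⊢
    · exact Or.inl (Or.inl (h1 t))
    · exact Or.inl (Or.inr (h2 t))
  · have hd0 : 0 ≤ d := dist_nonneg
    intro j k
    fin_cases j <;> fin_cases k <;> simp [dist_comm (f (σ 0)), ← hd, hd0]

end Transport

/-! ### Cones -/

/-- The inequalities are homogeneous and closed, and hold for any nonnegative vector whose
coordinates lie within η of those of l. Conversely, rescaling v to agree with l in one coordinate
places the others within ε of l when η is small. -/
theorem IsOpenPositiveCone.exists_closed_subcone {r : ℕ} (hr : 1 ≤ r) {C : Set (Fin r → ℝ)}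
    (hC : IsOpenPositiveCone C) {l : Fin r → ℝ} (hl : l ∈ C) :
    ∃ η > 0, (∀ i, η < l i) ∧ ∀ v : Fin r → ℝ, (∀ i, 0 ≤ v i) →
      (∀ i j, v i * (l j - η) ≤ v j * (l i + η)) → v ≠ 0 → v ∈ C := by
  obtain ⟨hopen, hpos, hcone⟩ := hC
  have hlpos := hpos l hl
  obtain ⟨ε, hε, hball⟩ := Metric.isOpen_iff.1 hopen l hl
  set i₀ : Fin r := ⟨0, hr⟩
  have hl0 := hlpos i₀
  have hup : ∀ j, ∀ᶠ η in 𝓝 (0 : ℝ), l i₀ * (l j + η) / (l i₀ - η) < l j + ε := by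
    intro j
    have hcont : ContinuousAt (fun η : ℝ => l i₀ * (l j + η) / (l i₀ - η)) 0 := by
      refine ContinuousAt.div (by fun_prop) (by fun_prop) ?_
      simpa using hl0.ne'
    refine hcont.eventually_lt_const ?_
    simp only [add_zero, sub_zero]
    rw [mul_div_cancel_left₀ _ hl0.ne']
    linarith
  have hlow : ∀ j, ∀ᶠ η in 𝓝 (0 : ℝ), l j - ε < l i₀ * (l j - η) / (l i₀ + η) := by
    intro j
    have hcont : ContinuousAt (fun η : ℝ => l i₀ * (l j - η) / (l i₀ + η)) 0 := by
      refine ContinuousAt.div (by fun_prop) (by fun_prop) ?_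
      simpa using hl0.ne'
    refine hcont.eventually_const_lt ?_
    simp only [add_zero, sub_zero]
    rw [mul_div_cancel_left₀ _ hl0.ne']
    linarith
  have hlt : ∀ j, ∀ᶠ η in 𝓝 (0 : ℝ), η < l j := fun j => eventually_lt_nhds (hlpos j)
  have hall : ∀ᶠ η in 𝓝[>] (0 : ℝ), 0 < η ∧ (∀ j, l i₀ * (l j + η) / (l i₀ - η) < l j + ε) ∧
      (∀ j, l j - ε < l i₀ * (l j - η) / (l i₀ + η)) ∧ ∀ j, η < l j := by
    filter_upwards [self_mem_nhdsWithin, (eventually_all.2 hup).filter_mono nhdsWithin_le_nhds,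
      (eventually_all.2 hlow).filter_mono nhdsWithin_le_nhds,
      (eventually_all.2 hlt).filter_mono nhdsWithin_le_nhds] with η h1 h2 h3 h4
    exact ⟨h1, h2, h3, h4⟩
  obtain ⟨η, hη, h1, h2, h3⟩ := hall.exists
  refine ⟨η, hη, h3, fun v hv0 hv hvne => ?_⟩
  have hvpos : 0 < v i₀ := by
    refine lt_of_le_of_ne (hv0 i₀) fun h => hvne (funext fun i => ?_)
    have h4 := hv i i₀
    rw [← h, zero_mul] at h4
    have := h3 i₀
    exact le_antisymm (nonpos_of_mul_nonpos_left h4 (by linarith)) (hv0 i)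
  set t := l i₀ / v i₀ with ht
  have ht0 : 0 < t := div_pos hl0 hvpos
  have htv : t * v i₀ = l i₀ := div_mul_cancel₀ _ hvpos.ne'
  have hmem : t • v ∈ C := by
    apply hball
    rw [Metric.mem_ball, dist_pi_lt_iff hε]
    intro j
    rw [Real.dist_eq, Pi.smul_apply, smul_eq_mul, abs_sub_lt_iff]
    constructor
    · have : t * v j ≤ l i₀ * (l j + η) / (l i₀ - η) := by
        rw [le_div_iff₀ (by linarith [h3 i₀]), mul_assoc, ← htv, mul_assoc]
        rw [htv]
        exact mul_le_mul_of_nonneg_left (hv j i₀) ht0.le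
      linarith [h1 j]
    · have : l i₀ * (l j - η) / (l i₀ + η) ≤ t * v j := by
        rw [div_le_iff₀ (by linarith), mul_assoc]
        nth_rewrite 1 [← htv]
        rw [mul_assoc]
        exact mul_le_mul_of_nonneg_left (hv i₀ j) ht0.le
      linarith [h2 j]
  have := hcone _ hmem t⁻¹ (inv_pos.2 ht0)
  rwa [smul_smul, inv_mul_cancel₀ ht0.ne', one_smul] at this

/-! ### Words in the factors and the main theorem -/

theorem lift_apply_factor {r : ℕ} {X : Fin r → Type*} [∀ i, MetricSpace (X i)]
    (f : Fin 2 → ∀ i, X i ≃ᵢ X i) (u : FreeGroup (Fin 2)) (i : Fin r) :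
    FreeGroup.lift f u i = FreeGroup.lift (fun j => f j i) u := by
  have : (Pi.evalMonoidHom (fun i => X i ≃ᵢ X i) i).comp (FreeGroup.lift f) =
      FreeGroup.lift fun j => f j i := by
    ext j
    simp
  exact DFunLike.congr_fun this u

theorem proposition6p5 {r : ℕ} (hr : 1 ≤ r) (X : Fin r → Type*) [∀ i, MetricSpace (X i)]
    [∀ i, LocallyCompactSpace (X i)] (hX : ∀ i, IsHadamardSpace (X i))
    (Γ : Subgroup (∀ i, X i ≃ᵢ X i)) (hΓ : ActsProperlyDiscontinuously Γ)
    (hgh : ∃ g ∈ Γ, ∃ h ∈ Γ, IsRegularAxial g ∧ IsRegularAxial h ∧ IndependentInFactors g h)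
    (C : Set (Fin r → ℝ)) (hC : IsOpenPositiveCone C) (hne : (C ∩ limitCone Γ).Nonempty) :
    ∃ Γ' : Subgroup (∀ i, X i ≃ᵢ X i), Γ' ≤ Γ ∧
      (∃ α β : ∀ i, X i ≃ᵢ X i,
        IsRegularAxial α ∧ IsRegularAxial β ∧ IndependentInFactors α β ∧
        Γ' = Subgroup.closure {α, β} ∧
        Function.Injective (FreeGroup.lift ![α, β])) ∧
      limitCone Γ' \ {0} ⊆ C := by
  set i₀ : Fin r := ⟨0, hr⟩
  obtain ⟨γ, hγΓ, hγ, hγC⟩ : ∃ γ ∈ Γ, IsRegularAxial γ ∧ translationVector γ ∈ C := by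
    obtain ⟨v, hvC, hv⟩ := hne
    obtain ⟨_, hwC, γ, hγΓ, hγ, s, hs, rfl⟩ := mem_closure_iff.1 hv C hC.1 hvC
    have hs0 : 0 < s := by
      refine lt_of_le_of_ne hs fun h => ?_
      have := hC.2.1 _ hwC i₀
      simp [← h] at this
    refine ⟨γ, hγΓ, hγ, ?_⟩
    have := hC.2.2 _ hwC s⁻¹ (inv_pos.2 hs0)
    rwa [smul_smul, inv_mul_cancel₀ hs0.ne', one_smul] at this
  obtain ⟨g, hgΓ, h, hhΓ, hg, hh, hind⟩ := hgh
  choose σg lg Kg hσg _ _ hKg using fun i => (hg i).exists_contracting_axis (hX i)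
  choose σh lh Kh hσh _ _ hKh using fun i => (hh i).exists_contracting_axis (hX i)
  choose σ l K hσ hflat hK0 hK using fun i => (hγ i).exists_contracting_axis (hX i)
  have hl : translationVector γ = l := funext fun i => (hσ i).translationLength_eq
  rw [hl] at hγC
  obtain ⟨n, k, hsep⟩ := exists_separating_zpow_mul_zpow hX hσg hσh hKg hKh hind
    fun i => (hσ i).2.1
  set δ : ∀ i, X i ≃ᵢ X i := g ^ n * h ^ k
  have hδΓ : δ ∈ Γ := Γ.mul_mem (Γ.zpow_mem hgΓ n) (Γ.zpow_mem hhΓ k)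
  choose D hD using fun i =>
    (hK i).exists_isPingPongPair (hX i) (hσ i).2.1 (hK0 i) (δ i) (hsep i)
  obtain ⟨η, hη, hηl, hcone⟩ := hC.exists_closed_subcone hr hγC
  -- K and D depend only on the lines σ i and δ i ∘ σ i, which are axes of the generators for every
  -- N. Hence N can be chosen after them, making the error per letter at most Nη.
  obtain ⟨N, hN⟩ : ∃ N : ℕ, 0 < N ∧ (∀ i, 10 * (K i + D i) < N * l i) ∧
      ∀ i, 10 * (K i + D i) ≤ N * η := by
    have e1 : ∀ i, ∀ᶠ N : ℕ in atTop, 10 * (K i + D i) < N * l i := fun i =>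
      (tendsto_natCast_atTop_atTop.atTop_mul_const (hσ i).1).eventually_gt_atTop _
    have e2 : ∀ i, ∀ᶠ N : ℕ in atTop, 10 * (K i + D i) ≤ N * η := fun i =>
      (tendsto_natCast_atTop_atTop.atTop_mul_const hη).eventually_ge_atTop _
    exact ((eventually_gt_atTop 0).and
      ((eventually_all.2 e1).and (eventually_all.2 e2))).exists
  obtain ⟨hN0, hN1, hN2⟩ := hN
  set α : ∀ i, X i ≃ᵢ X i := γ ^ N with hα
  set β : ∀ i, X i ≃ᵢ X i := δ * γ ^ N * δ⁻¹ with hβ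
  have hαax : ∀ i, IsAxis (α i) (σ i) (N * l i) := fun i => (hσ i).pow hN0
  have hβax : ∀ i, IsAxis (β i) (fun t => δ i (σ i t)) (N * l i) := fun i => (hαax i).conj (δ i)
  have hs : ∀ i j t, ![α, β] j i (![σ i, fun t => δ i (σ i t)] j t) =
      ![σ i, fun t => δ i (σ i t)] j (t + N * l i) := by
    intro i j t
    fin_cases j
    · exact (hαax i).2.2 t
    · exact (hβax i).2.2 t
  refine ⟨Subgroup.closure {α, β}, ?_, ⟨α, β, fun i => ⟨_, _, hαax i, hflat i⟩,
    fun i => ⟨_, _, hβax i, not_boundsFlatHalfPlane_map (hflat i) (δ i)⟩, fun i => ?_, rfl, ?_⟩, ?_⟩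
  · rw [Subgroup.closure_le]
    have hαΓ : α ∈ Γ := Γ.pow_mem hγΓ N
    rintro x (rfl | rfl)
    · exact hαΓ
    · exact Γ.mul_mem (Γ.mul_mem hδΓ hαΓ) (Γ.inv_mem hδΓ)
  · exact (hX i).independentIsometries_of_not_asymptotic (hαax i) (hβax i)
      fun b b' hb => hsep i b' b hb.symm
  -- Freeness in a single factor suffices; r ≥ 1 provides one.
  · intro u v huv
    refine (hD i₀).lift_injective (hX i₀) (hs i₀) (hN1 i₀) ?_
    rw [← lift_apply_factor, ← lift_apply_factor, huv]
  · rintro v ⟨hv, hv0⟩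
    have hclosed : IsClosed {v : Fin r → ℝ | (∀ i, 0 ≤ v i) ∧
        ∀ i j, v i * (l j - η) ≤ v j * (l i + η)} := by
      simp only [ofPred_and, ofPred_forall]
      refine (isClosed_iInter fun i => isClosed_le (by fun_prop) (by fun_prop)).inter
        (isClosed_iInter fun i => isClosed_iInter fun j =>
          isClosed_le (by fun_prop) (by fun_prop))
    obtain ⟨h1, h2⟩ := closure_minimal (t := {v : Fin r → ℝ | (∀ i, 0 ≤ v i) ∧
        ∀ i j, v i * (l j - η) ≤ v j * (l i + η)}) (by
      rintro _ ⟨w, hw, hwax, s, hs0, rfl⟩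
      obtain ⟨u, rfl⟩ : ∃ u, FreeGroup.lift ![α, β] u = w := by
        have : w ∈ (FreeGroup.lift ![α, β]).range := by
          rw [FreeGroup.range_lift_eq_closure]
          simpa [pair_comm] using hw
        exact this
      choose ρ m hm _ using hwax
      have hmt : translationVector (FreeGroup.lift ![α, β] u) = m :=
        funext fun i => (hm i).translationLength_eq
      rw [hmt]
      set c : ℝ := ((FreeGroup.reduceCyclically u.toWord).length : ℝ)
      have hc0 : 0 ≤ c := Nat.cast_nonneg _
      -- The word length c is common to all factors. Multiplying the upper bound in factor i by the
      -- lower bound in factor j cancels cN and gives the inequalities of the closed subcone.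
      have hbd : ∀ i, c * N * (l i - η) ≤ m i ∧ m i ≤ c * N * (l i + η) := by
        intro i
        have hmi := hm i
        rw [lift_apply_factor] at hmi
        obtain ⟨b1, b2⟩ := (hD i).translation_bounds (hX i) (hs i) (hN1 i) u hmi
        have h3 : c * (10 * (K i + D i)) ≤ c * (N * η) := mul_le_mul_of_nonneg_left (hN2 i) hc0
        constructor <;> linarith
      refine ⟨fun i => mul_nonneg hs0 (hm i).1.le, fun i j => ?_⟩
      simp only [Pi.smul_apply, smul_eq_mul]
      rw [mul_assoc, mul_assoc]
      refine mul_le_mul_of_nonneg_left ?_ hs0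
      have h3 := mul_le_mul_of_nonneg_right (hbd i).2 (by linarith [hηl j] : 0 ≤ l j - η)
      have h4 := mul_le_mul_of_nonneg_right (hbd j).1 (by linarith [hηl i] : 0 ≤ l i + η)
      linarith) hclosed hv
    exact hcone v h1 h2 hv0
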